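/- Let $(\mathcal V,\otimes,I,\tau)$ be a braided monoidal category with equalisers and coequalisers (coherence isomorphisms are suppressed below), and let $\mathcal A=(A,m,e)$ be an algebra in $\mathcal V$. \emph{Notation.} Put $m^\tau=m\cdot\tau_{A,A}$, let $\mathcal A^\tau=(A,m^\tau,e)$ be the opposite algebra, and let $\mathcal A^e=\mathcal A\otimes\mathcal A^\tau$ and ${}^e\!\mathcal A=\mathcal A^\tau\otimes\mathcal A$ be the braided tensor product algebras. For a monad $\mathbf F=(F,m,e)$ with a distributive law $\lambda:FF\to FF$ satisfying the Yang--Baxter equation, $\mathbf F^\lambda=(F,m\lambda,e)$ is a monad, $\lambda$ is a distributive law $\mathbf F^\lambda\mathbf F\to\mathbf F\mathbf F^\lambda$ making $\mathbf F\mathbf F^\lambda$ a monad, and $\mathbf F$ is called \emph{Azumaya} (with respect to $\lambda$) if the comparison functor $X\mapsto (F(X),\,m_X\cdot F(m_X)\cdot F(\lambda_X))$ from the base category to the category of $\mathbf F\mathbf F^\lambda$-modules is an equivalence. $\mathcal A$ is \emph{left Azumaya} if the monad $A\otimes-$ with the law $\tau_{A,A}\otimes-$ is Azumaya, and \emph{right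 Azumaya} if the monad $-\otimes A$ with the law $-\otimes\tau_{A,A}$ is Azumaya. A \emph{left dual} of $V$ is an object $V^*$ with $\mathrm{db}:I\to V\otimes V^*$ and $\mathrm{ev}:V^*\otimes V\to I$ satisfying the triangle identities; a \emph{right dual} of $V$ is an object $V^\sharp$ with $\mathrm{db}':I\to V^\sharp\otimes V$ and $\mathrm{ev}':V\otimes V^\sharp\to I$ satisfying the triangle identities. $V$ is \emph{finite} if it has a left dual. $V\otimes V^*$ is an algebra with multiplication $V\otimes\mathrm{ev}\otimes V^*$ and unit $\mathrm{db}$, and $V^\sharp\otimes V$ is an algebra with multiplication $V^\sharp\otimes\mathrm{ev}'\otimes V$ and unit $\mathrm{db}'$. A left $\mathcal B$-module $(V,\rho)$ is \emph{faithfully Galois} if $V$ has a left dual, $(\rho\otimes V^*)(B\otimes\mathrm{db}):B\to V\otimes V^*$ is an isomorphism of algebras, and the functor $V\otimes-$ is conservative. A right $\mathcal B$-module $(V,\varrho)$ is \emph{faithfully Galois} if $V$ has a right dual, $(V^\sharp\otimes\varrho)(\mathrm{db}'\otimes B):B\to V^\sharp\otimes V$ is an isomorphism of algebras, and $-\otimes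 V$ is conservative. A functor is \emph{monadic} (\emph{comonadic}) if it is a right (left) adjoint and the comparison functor to the Eilenberg--Moore category of the induced monad (comonad) is an equivalence. \textbf{Theorem.} The following are equivalent: \begin{enumerate} \item[(a)] $\mathcal A$ is left Azumaya; \item[(b)] the left $\mathcal A^e$-module $(A,\;m\cdot(A\otimes m^\tau))$ is faithfully Galois; \item[(c)] $A$ is finite with a right dual $(A^\sharp,\mathrm{db}',\mathrm{ev}')$, the free functor $V\mapsto(A\otimes V,\,m^\tau\otimes V)$ from $\mathcal V$ to the category of left $\mathcal A^\tau$-modules is comonadic, and the composite $$\overline\chi:\;A\otimes A\xrightarrow{\mathrm{db}'\otimes A\otimes A}A^\sharp\otimes A\otimes A\otimes A\xrightarrow{A^\sharp\otimes m\otimes A}A^\sharp\otimes A\otimes A\xrightarrow{A^\sharp\otimes\tau_{A,A}}A^\sharp\otimes A\otimes A\xrightarrow{A^\sharp\otimes m}A^\sharp\otimes A$$ is an isomorphism; \item[(d)] $A$ is finite with a right dual $(A^\sharp,\mathrm{db}',\mathrm{ev}')$, the functor $-\otimes A:\mathcal V\to\mathcal V$ is monadic, and the composite $$\overline\chi_1:\;A\otimes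 A\xrightarrow{\mathrm{db}'\otimes A\otimes A}A^\sharp\otimes A\otimes A\otimes A\xrightarrow{A^\sharp\otimes\tau_{A,A}\otimes A}A^\sharp\otimes A\otimes A\otimes A\xrightarrow{A^\sharp\otimes m\otimes A}A^\sharp\otimes A\otimes A\xrightarrow{A^\sharp\otimes m}A^\sharp\otimes A$$ is an isomorphism; \item[(e)] the right ${}^e\!\mathcal A$-module $(A,\;m\cdot(m^\tau\otimes A))$ is faithfully Galois; \item[(f)] $\mathcal A$ is right Azumaya. \end{enumerate} -/

import Mathlib

open CategoryTheory MonoidalCategory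

universe v u

namespace AzumayaTheory

section Monads

variable {C : Type u} [Category.{v} C]

/-- A distributive law of a monad `T` over a monad `S`: a natural transformation `TS ⟶ ST`
(`TS` is "first `S`, then `T`") compatible with the units and the multiplications. -/
structure DistribLaw (T S : Monad C) where
  hom : S.toFunctor ⋙ T.toFunctor ⟶ T.toFunctor ⋙ S.toFunctor
  unit_left : ∀ X : C, T.η.app (S.obj X) ≫ hom.app X = S.map (T.η.app X)
  unit_right : ∀ X : C, T.map (S.η.app X) ≫ hom.app X = S.η.app (T.obj X)
  mul_left : ∀ X : C, T.μ.app (S.obj X) ≫ hom.app X =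
    T.map (hom.app X) ≫ hom.app (T.obj X) ≫ S.map (T.μ.app X)
  mul_right : ∀ X : C, T.map (S.μ.app X) ≫ hom.app X =
    hom.app (S.obj X) ≫ S.map (hom.app X) ≫ S.μ.app (T.obj X)

theorem DistribLaw.nat {T S : Monad C} (l : DistribLaw T S) {X Y : C} (f : X ⟶ Y) :
    T.map (S.map f) ≫ l.hom.app Y = l.hom.app X ≫ S.map (T.map f) :=
  l.hom.naturality f

theorem DistribLaw.nat_assoc {T S : Monad C} (l : DistribLaw T S) {X Y Z : C} (f : X ⟶ Y)
    (h : S.obj (T.obj Y) ⟶ Z) :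
    T.map (S.map f) ≫ l.hom.app Y ≫ h = l.hom.app X ≫ S.map (T.map f) ≫ h := by
  rw [← Category.assoc, l.nat, Category.assoc]

/-- The monad `ST` (with functor part "first `T`, then `S`") given by a distributive law
`TS ⟶ ST`. Its multiplication is `STST ⟶ SSTT ⟶ ST`. -/
def DistribLaw.compMonad {T S : Monad C} (l : DistribLaw T S) : Monad C where
  toFunctor := T.toFunctor ⋙ S.toFunctor
  η :=
    { app := fun X => T.η.app X ≫ S.η.app (T.obj X)
      naturality := fun X Y f => by
        have h1 := T.η.naturality f
        have h2 := S.η.naturality (T.map f)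
        dsimp at h1 h2 ⊢
        rw [reassoc_of% h1, h2, Category.assoc] }
  μ :=
    { app := fun X => S.map (l.hom.app (T.obj X)) ≫ S.map (S.map (T.μ.app X)) ≫ S.μ.app (T.obj X)
      naturality := fun X Y f => by
        have h1 := T.μ.naturality f
        have h2 := S.μ.naturality (T.map f)
        have h3 := l.nat (T.map f)
        dsimp at h1 h2 h3 ⊢
        simp only [Category.assoc]
        rw [← h2]
        simp only [← Functor.map_comp_assoc]
        rw [← Functor.map_comp, ← h1, reassoc_of% h3]
        simp only [Functor.map_comp, Category.assoc] }
  assoc X := by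
    have h1 := l.mul_right (T.obj X)
    have h2 := l.mul_left (T.obj X)
    have h3 := T.assoc X
    have h4 := S.assoc (T.obj X)
    have h5 := S.μ.naturality (T.μ.app X)
    have h6 := S.μ.naturality (l.hom.app (T.obj X) ≫ S.map (T.μ.app X))
    dsimp at h1 h2 h3 h4 h5 h6 ⊢
    simp only [Functor.map_comp, Category.assoc] at h6 ⊢
    rw [← reassoc_of% h6]
    simp only [← Functor.map_comp_assoc, ← Functor.map_comp]
    rw [← h4, reassoc_of% h2, ← Functor.map_comp, ← h3]
    simp only [← Functor.map_comp_assoc, Category.assoc]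
    rw [Functor.map_comp T.toFunctor, Category.assoc, reassoc_of% h1, ← h5, l.nat_assoc]
    simp only [Functor.map_comp, Category.assoc]
    have h7 := congrArg (fun g => S.map (S.map g)) (l.nat (T.μ.app X))
    simp only [Functor.map_comp] at h7
    rw [reassoc_of% h7]
  left_unit X := by
    have h1 := l.unit_left (T.obj X)
    have h2 := S.η.naturality (l.hom.app (T.obj X) ≫ S.map (T.μ.app X))
    have h3 := T.left_unit X
    dsimp at h1 h2 h3 ⊢
    simp only [Functor.map_comp, Category.assoc] at h2 ⊢
    rw [← reassoc_of% h2, reassoc_of% h1, ← Functor.map_comp_assoc, h3]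
    simp
  right_unit X := by
    have h1 := l.unit_right (T.obj X)
    have h2 := S.η.naturality (T.μ.app X)
    have h3 := T.right_unit X
    dsimp at h1 h2 h3 ⊢
    simp only [← Functor.map_comp_assoc]
    rw [Functor.map_comp T.toFunctor, Category.assoc, reassoc_of% h1, ← h2, reassoc_of% h3]
    simp

/-- A BD-law on a monad `F`: a distributive law `FF ⟶ FF` satisfying the Yang-Baxter equation. -/
structure BDLaw (F : Monad C) extends DistribLaw F F where
  yang_baxter : ∀ X : C,
    F.map (hom.app X) ≫ hom.app (F.obj X) ≫ F.map (hom.app X) =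
      hom.app (F.obj X) ≫ F.map (hom.app X) ≫ hom.app (F.obj X)

/-- The opposite monad `F^λ`, with multiplication `m · λ`. -/
def BDLaw.oppositeMonad {F : Monad C} (l : BDLaw F) : Monad C where
  toFunctor := F.toFunctor
  η := F.η
  μ := l.hom ≫ F.μ
  assoc X := by
    have h1 := l.mul_right X
    have h2 := l.mul_left X
    have h3 := F.assoc X
    have h4 := l.yang_baxter X
    dsimp at h1 h2 h3 h4 ⊢
    simp only [Functor.map_comp, Category.assoc]
    rw [reassoc_of% h1, reassoc_of% h2, ← h3, reassoc_of% h4]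
  left_unit X := by
    have h1 := l.unit_left X
    have h2 := F.right_unit X
    dsimp at h1 h2 ⊢
    rw [reassoc_of% h1, h2]
  right_unit X := by
    have h1 := l.unit_right X
    have h2 := F.left_unit X
    dsimp at h1 h2 ⊢
    rw [reassoc_of% h1, h2]

/-- `λ`, regarded as a distributive law `F^λ F ⟶ F F^λ`. -/
def BDLaw.oppositeLaw {F : Monad C} (l : BDLaw F) : DistribLaw l.oppositeMonad F where
  hom := l.hom
  unit_left := l.unit_left
  unit_right := l.unit_right
  mul_left X := by
    have h2 := l.mul_left X
    have h4 := l.yang_baxter X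
    dsimp [BDLaw.oppositeMonad] at h2 h4 ⊢
    simp only [Functor.map_comp, Category.assoc]
    rw [h2, ← reassoc_of% h4]
  mul_right := l.mul_right

/-- The comparison functor from `C` to the category of modules over the monad `F F^λ`,
`X ↦ (F X, m · F m · F λ)`. -/
def BDLaw.comparison {F : Monad C} (l : BDLaw F) : C ⥤ l.oppositeLaw.compMonad.Algebra where
  obj X :=
    { A := F.obj X
      a := F.map (l.hom.app X) ≫ F.map (F.μ.app X) ≫ F.μ.app X
      unit := by
        have h1 := l.unit_left X
        have h2 := F.right_unit X
        have h3 := F.left_unit X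
        have h4 := F.η.naturality (l.hom.app X ≫ F.μ.app X)
        dsimp [DistribLaw.compMonad, BDLaw.oppositeMonad] at h1 h2 h3 h4 ⊢
        simp only [Functor.map_comp, Category.assoc] at h4 ⊢
        rw [← reassoc_of% h4, reassoc_of% h1, reassoc_of% h2, h3]
      assoc := by
        have h1 := l.mul_right X
        have h2 := F.assoc X
        have h3 := l.oppositeMonad.assoc X
        have h4 := l.nat (l.hom.app X ≫ F.μ.app X)
        have h5 := F.μ.naturality (l.hom.app X ≫ F.μ.app X)
        dsimp [DistribLaw.compMonad, BDLaw.oppositeMonad, BDLaw.oppositeLaw] at h1 h2 h3 h4 h5 ⊢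
        simp only [← Functor.map_comp_assoc, Category.assoc] at h5 ⊢
        rw [← reassoc_of% h5, ← h2]
        simp only [← Functor.map_comp_assoc, Category.assoc]
        rw [Category.assoc] at h3
        rw [← h3]
        replace h1 := congrArg (fun g => F.map g) h1
        replace h2 := congrArg (fun g => F.map g) h2
        replace h4 := congrArg (fun g => F.map g) h4
        simp only [Functor.map_comp, Category.assoc] at h1 h2 h4 ⊢
        rw [reassoc_of% h1, reassoc_of% h4, reassoc_of% h2] }
  map f :=
    { f := F.map f
      h := by
        have h1 := l.nat f
        have h2 := F.μ.naturality f
        dsimp [DistribLaw.compMonad, BDLaw.oppositeMonad] at h1 h2 ⊢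
        simp only [← Functor.map_comp_assoc, Category.assoc, ← h2]
        rw [reassoc_of% h1] }
  map_id X := by ext; simp
  map_comp f g := by ext; simp

/-- A monad is Azumaya, with respect to a BD-law `λ`, if the comparison functor to the category
of `F F^λ`-modules is an equivalence. -/
def BDLaw.IsAzumaya {F : Monad C} (l : BDLaw F) : Prop := l.comparison.IsEquivalence

end Monads

section Algebras

variable {C : Type u} [Category.{v} C] [MonoidalCategory C]

/-- The monad `A ⊗ -` of an algebra `A`. -/
def leftMonad (A : Mon C) : Monad C where
  toFunctor := tensorLeft A.X
  η :=
    { app := fun X => (λ_ X).inv ≫ MonObj.one ▷ X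
      naturality := fun X Y f => by simp [← whisker_exchange] }
  μ :=
    { app := fun X => (α_ A.X A.X X).inv ≫ MonObj.mul ▷ X
      naturality := fun X Y f => by simp [← whisker_exchange] }
  assoc X := by
    dsimp
    calc _ = 𝟙 _ ⊗≫ (A.X ◁ MonObj.mul ≫ MonObj.mul) ▷ X := by monoidal
      _ = _ := by rw [MonObj.mul_assoc_flip]; monoidal
  left_unit X := by
    dsimp
    calc _ = 𝟙 _ ⊗≫ (MonObj.one ▷ A.X ≫ MonObj.mul) ▷ X := by monoidal
      _ = _ := by rw [MonObj.one_mul]; monoidal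
  right_unit X := by
    dsimp
    calc _ = 𝟙 _ ⊗≫ (A.X ◁ MonObj.one ≫ MonObj.mul) ▷ X := by monoidal
      _ = _ := by rw [MonObj.mul_one]; monoidal

/-- The monad `- ⊗ A` of an algebra `A`. -/
def rightMonad (A : Mon C) : Monad C where
  toFunctor := tensorRight A.X
  η :=
    { app := fun X => (ρ_ X).inv ≫ X ◁ MonObj.one
      naturality := fun X Y f => by simp [whisker_exchange] }
  μ :=
    { app := fun X => (α_ X A.X A.X).hom ≫ X ◁ MonObj.mul
      naturality := fun X Y f => by simp [whisker_exchange] }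
  assoc X := by
    dsimp
    calc _ = 𝟙 _ ⊗≫ X ◁ (MonObj.mul ▷ A.X ≫ MonObj.mul) := by monoidal
      _ = _ := by rw [MonObj.mul_assoc]; monoidal
  left_unit X := by
    dsimp
    calc _ = 𝟙 _ ⊗≫ X ◁ (A.X ◁ MonObj.one ≫ MonObj.mul) := by monoidal
      _ = _ := by rw [MonObj.mul_one]; monoidal
  right_unit X := by
    dsimp
    calc _ = 𝟙 _ ⊗≫ X ◁ (MonObj.one ▷ A.X ≫ MonObj.mul) := by monoidal
      _ = _ := by rw [MonObj.one_mul]; monoidal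

/-- A right module over an algebra `B`. -/
structure RightModule (B : Mon C) where
  X : C
  act : X ⊗ B.X ⟶ X
  act_one : X ◁ MonObj.one ≫ act = (ρ_ X).hom
  act_mul : X ◁ MonObj.mul ≫ act = (α_ X B.X B.X).inv ≫ act ▷ B.X ≫ act

/-- For an exact pairing `(V, W)`, with unit `db : 𝟙 ⟶ V ⊗ W` and counit `ev : W ⊗ V ⟶ 𝟙`,
the algebra `V ⊗ W` with multiplication `V ⊗ ev ⊗ W` and unit `db`. -/
def pairingAlgebra (V W : C) [ExactPairing V W] : Mon C where
  X := V ⊗ W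
  mon :=
    { one := η_ V W
      mul := (α_ V W (V ⊗ W)).hom ≫ V ◁ ((α_ W V W).inv ≫ ε_ V W ▷ W ≫ (λ_ W).hom)
      one_mul := by
        calc _ = 𝟙 _ ⊗≫ (η_ V W ▷ V ≫ (α_ V W V).hom ≫ V ◁ ε_ V W) ▷ W ⊗≫ 𝟙 _ := by monoidal
          _ = _ := by rw [ExactPairing.evaluation_coevaluation]; monoidal
      mul_one := by
        calc _ = 𝟙 _ ⊗≫ V ◁ (W ◁ η_ V W ≫ (α_ W V W).inv ≫ ε_ V W ▷ W) ⊗≫ 𝟙 _ := by monoidal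
          _ = _ := by rw [ExactPairing.coevaluation_evaluation]; monoidal
      mul_assoc := by
        calc _ = 𝟙 _ ⊗≫ V ◁ (ε_ V W ▷ (W ⊗ V) ≫ 𝟙_ C ◁ ε_ V W) ▷ W ⊗≫ 𝟙 _ := by monoidal
          _ = _ := by rw [← whisker_exchange]; monoidal }

/-- For a left `B`-module `V` and an exact pairing `(V, W)` (so that `W` is left adjoint to `V`),
the mate `B ⟶ B ⊗ V ⊗ W ⟶ V ⊗ W` of the action. -/
def leftMate {B : Mon C} (V : Mod C B.X) (W : C) [ExactPairing V.X W] :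
    B.X ⟶ (pairingAlgebra V.X W).X :=
  (ρ_ B.X).inv ≫ B.X ◁ η_ V.X W ≫ (α_ B.X V.X W).inv ≫ (ModObj.smul (M := B.X) (X := V.X) : B.X ⊗ V.X ⟶ V.X) ▷ W

/-- The left `B`-module `V` is Galois: the mate of its action is an isomorphism of algebras
from `B` to `V ⊗ W`, where `W` is left adjoint to `V`. -/
def IsLeftGalois {B : Mon C} (V : Mod C B.X) (W : C) [ExactPairing V.X W] : Prop :=
  IsMonHom (leftMate V W) ∧ IsIso (leftMate V W)

/-- The left `B`-module `V` is faithfully Galois: `V` has a left adjoint, `V` is Galois, and the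
functor `V ⊗ -` is conservative. -/
def IsLeftFaithfullyGalois {B : Mon C} (V : Mod C B.X) : Prop :=
  (∃ (W : C) (_ : ExactPairing V.X W), IsLeftGalois V W) ∧
    (tensorLeft V.X).ReflectsIsomorphisms

/-- For a right `B`-module `V` and an exact pairing `(W, V)` (so that `W` is right adjoint to `V`),
the mate `B ⟶ W ⊗ V ⊗ B ⟶ W ⊗ V` of the action. -/
def rightMate {B : Mon C} (V : RightModule B) (W : C) [ExactPairing W V.X] :
    B.X ⟶ (pairingAlgebra W V.X).X :=
  (λ_ B.X).inv ≫ η_ W V.X ▷ B.X ≫ (α_ W V.X B.X).hom ≫ W ◁ V.act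

/-- The right `B`-module `V` is Galois: the mate of its action is an isomorphism of algebras
from `B` to `W ⊗ V`, where `W` is right adjoint to `V`. -/
def IsRightGalois {B : Mon C} (V : RightModule B) (W : C) [ExactPairing W V.X] : Prop :=
  IsMonHom (rightMate V W) ∧ IsIso (rightMate V W)

/-- The right `B`-module `V` is faithfully Galois: `V` has a right adjoint, `V` is Galois, and the
functor `- ⊗ V` is conservative. -/
def IsRightFaithfullyGalois {B : Mon C} (V : RightModule B) : Prop :=
  (∃ (W : C) (_ : ExactPairing W V.X), IsRightGalois V W) ∧
    (tensorRight V.X).ReflectsIsomorphisms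

/-- An object `V` is finite if it has a left adjoint `W`, i.e. if there are `𝟙 ⟶ V ⊗ W` and
`W ⊗ V ⟶ 𝟙` satisfying the triangle identities. -/
def IsFiniteObj (V : C) : Prop := ∃ W : C, Nonempty (ExactPairing V W)

end Algebras

section Braided

variable {C : Type u} [Category.{v} C] [MonoidalCategory C] [BraidedCategory C]

/-- The opposite algebra, with multiplication `m · τ`. -/
def opAlgebra (A : Mon C) : Mon C where
  X := A.X
  mon :=
    { one := MonObj.one
      mul := (β_ A.X A.X).hom ≫ MonObj.mul
      one_mul := by simp
      mul_one := by simp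
      mul_assoc := by
        have h := BraidedCategory.yang_baxter A.X A.X A.X
        replace h := congrArg (fun f => f ≫ A.X ◁ MonObj.mul ≫ MonObj.mul) h
        simp only [Category.assoc] at h
        rw [Iso.inv_comp_eq] at h
        simpa using h }

/-- The enveloping algebra `A ⊗ A^τ` (braided tensor product). -/
def leftEnv (A : Mon C) : Mon C := A ⊗ opAlgebra A

/-- The enveloping algebra `A^τ ⊗ A` (braided tensor product). -/
def rightEnv (A : Mon C) : Mon C := opAlgebra A ⊗ A

theorem whiskerLeft_mul_opMul (A : Mon C) :
    A.X ◁ MonObj.mul ≫ (β_ A.X A.X).hom ≫ MonObj.mul =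
      (α_ A.X A.X A.X).inv ≫ (β_ A.X A.X).hom ▷ A.X ≫ (α_ A.X A.X A.X).hom ≫
        A.X ◁ ((β_ A.X A.X).hom ≫ MonObj.mul) ≫ MonObj.mul := by
  simp

theorem opMul_whiskerRight_mul (A : Mon C) :
    MonObj.mul ▷ A.X ≫ (β_ A.X A.X).hom ≫ MonObj.mul =
      (α_ A.X A.X A.X).hom ≫ A.X ◁ (β_ A.X A.X).hom ≫ (α_ A.X A.X A.X).inv ≫
        ((β_ A.X A.X).hom ≫ MonObj.mul) ▷ A.X ≫ MonObj.mul := by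
  simp

/-- `A` as a left `A ⊗ A^τ`-module: `(A ⊗ A^τ) ⊗ A ⟶ A`, `m · (A ⊗ m^τ)`. -/
def leftEnvModule (A : Mon C) : Mod C (leftEnv A).X where
  X := A.X
  mod :=
    { smul := (α_ A.X A.X A.X).hom ≫ A.X ◁ ((β_ A.X A.X).hom ≫ MonObj.mul) ≫ MonObj.mul
      one_smul := by
        have h1 := MonObj.one_mul (opAlgebra A).X
        change MonObj.one ▷ A.X ≫ (β_ A.X A.X).hom ≫ MonObj.mul = (λ_ A.X).hom at h1
        change ((λ_ (𝟙_ C)).inv ≫ (MonObj.one ⊗ₘ MonObj.one)) ▷ A.X ≫ _ = (λ_ A.X).hom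
        generalize (β_ A.X A.X).hom ≫ MonObj.mul = n at *
        rw [MonoidalCategory.tensorHom_def]
        calc _ = 𝟙 _ ⊗≫ (MonObj.one : 𝟙_ C ⟶ A.X) ▷ (𝟙_ C ⊗ A.X) ⊗≫ A.X ◁ (MonObj.one ▷ A.X ≫ n) ≫
                MonObj.mul := by monoidal
          _ = 𝟙 _ ⊗≫ (MonObj.one ▷ A.X ≫ MonObj.mul) := by rw [h1]; monoidal
          _ = _ := by rw [MonObj.one_mul]; monoidal
      mul_smul := by
        have h1 := MonObj.mul_assoc (opAlgebra A).X
        change ((β_ A.X A.X).hom ≫ MonObj.mul) ▷ A.X ≫ (β_ A.X A.X).hom ≫ MonObj.mul =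
          (α_ A.X A.X A.X).hom ≫ A.X ◁ ((β_ A.X A.X).hom ≫ MonObj.mul) ≫
            (β_ A.X A.X).hom ≫ MonObj.mul at h1
        have h2 := whiskerLeft_mul_opMul A
        change (tensorμ A.X A.X A.X A.X ≫ (MonObj.mul ⊗ₘ ((β_ A.X A.X).hom ≫ MonObj.mul))) ▷ A.X ≫
          _ = (α_ (A.X ⊗ A.X) (A.X ⊗ A.X) A.X).hom ≫ (A.X ⊗ A.X) ◁ _ ≫ _
        generalize (β_ A.X A.X).hom ≫ MonObj.mul = n at *
        rw [MonoidalCategory.tensorHom_def, tensorμ]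
        calc _ = 𝟙 _ ⊗≫ A.X ◁ ((β_ A.X A.X).hom ▷ (A.X ⊗ A.X)) ⊗≫
                (MonObj.mul ▷ ((A.X ⊗ A.X) ⊗ A.X) ≫ A.X ◁ (n ▷ A.X ≫ n)) ≫ MonObj.mul := by monoidal
          _ = 𝟙 _ ⊗≫ A.X ◁ ((β_ A.X A.X).hom ▷ (A.X ⊗ A.X) ≫ (A.X ⊗ A.X) ◁ n) ⊗≫
                (A.X ⊗ A.X) ◁ n ⊗≫ (MonObj.mul ▷ A.X ≫ MonObj.mul) := by
              rw [← whisker_exchange, h1]; monoidal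
          _ = 𝟙 _ ⊗≫ A.X ◁ A.X ◁ A.X ◁ n ⊗≫ A.X ◁ ((α_ A.X A.X A.X).inv ≫
                (β_ A.X A.X).hom ▷ A.X ≫ (α_ A.X A.X A.X).hom ≫ A.X ◁ n ≫ MonObj.mul) ≫ MonObj.mul := by
              rw [← whisker_exchange, MonObj.mul_assoc]; monoidal
          _ = _ := by rw [← h2]; monoidal }

/-- `A` as a right `A^τ ⊗ A`-module: `A ⊗ (A^τ ⊗ A) ⟶ A`, `m · (m^τ ⊗ A)`. -/
def rightEnvModule (A : Mon C) : RightModule (rightEnv A) where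
  X := A.X
  act := (α_ A.X A.X A.X).inv ≫ ((β_ A.X A.X).hom ≫ MonObj.mul) ▷ A.X ≫ MonObj.mul
  act_one := by
    have h1 := MonObj.mul_one (opAlgebra A).X
    change A.X ◁ MonObj.one ≫ (β_ A.X A.X).hom ≫ MonObj.mul = (ρ_ A.X).hom at h1
    change A.X ◁ ((λ_ (𝟙_ C)).inv ≫ (MonObj.one ⊗ₘ MonObj.one)) ≫ _ = (ρ_ A.X).hom
    generalize (β_ A.X A.X).hom ≫ MonObj.mul = n at *
    rw [MonoidalCategory.tensorHom_def']
    calc _ = 𝟙 _ ⊗≫ (A.X ⊗ 𝟙_ C) ◁ (MonObj.one : 𝟙_ C ⟶ A.X) ⊗≫ (A.X ◁ MonObj.one ≫ n) ▷ A.X ≫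
            MonObj.mul := by monoidal
      _ = 𝟙 _ ⊗≫ (A.X ◁ MonObj.one ≫ MonObj.mul) := by rw [h1]; monoidal
      _ = _ := by rw [MonObj.mul_one]; monoidal
  act_mul := by
    have h1 := MonObj.mul_assoc_flip (opAlgebra A).X
    change A.X ◁ ((β_ A.X A.X).hom ≫ MonObj.mul) ≫ (β_ A.X A.X).hom ≫ MonObj.mul =
      (α_ A.X A.X A.X).inv ≫ ((β_ A.X A.X).hom ≫ MonObj.mul) ▷ A.X ≫
        (β_ A.X A.X).hom ≫ MonObj.mul at h1
    have h2 := opMul_whiskerRight_mul A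
    change A.X ◁ (tensorμ A.X A.X A.X A.X ≫ (((β_ A.X A.X).hom ≫ MonObj.mul) ⊗ₘ MonObj.mul)) ≫
      _ = (α_ A.X (A.X ⊗ A.X) (A.X ⊗ A.X)).inv ≫ _ ▷ (A.X ⊗ A.X) ≫ _
    generalize (β_ A.X A.X).hom ≫ MonObj.mul = n at *
    rw [MonoidalCategory.tensorHom_def', tensorμ]
    calc _ = 𝟙 _ ⊗≫ ((A.X ⊗ A.X) ◁ (β_ A.X A.X).hom) ▷ A.X ⊗≫
            ((A.X ⊗ A.X ⊗ A.X) ◁ MonObj.mul ≫ (A.X ◁ n ≫ n) ▷ A.X) ≫ MonObj.mul := by monoidal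
      _ = 𝟙 _ ⊗≫ ((A.X ⊗ A.X) ◁ (β_ A.X A.X).hom ≫ n ▷ (A.X ⊗ A.X)) ▷ A.X ⊗≫
            n ▷ (A.X ⊗ A.X) ⊗≫ (A.X ◁ MonObj.mul ≫ MonObj.mul) := by
          rw [whisker_exchange, h1]; monoidal
      _ = 𝟙 _ ⊗≫ n ▷ A.X ▷ A.X ▷ A.X ⊗≫ ((α_ A.X A.X A.X).hom ≫ A.X ◁ (β_ A.X A.X).hom ≫
            (α_ A.X A.X A.X).inv ≫ n ▷ A.X ≫ MonObj.mul) ▷ A.X ≫ MonObj.mul := by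
          rw [whisker_exchange, MonObj.mul_assoc_flip]; monoidal
      _ = _ := by rw [← h2]; monoidal

/-- The BD-law `τ ⊗ V` on the monad `A ⊗ -` given by the braiding. -/
def leftBDLaw (A : Mon C) : BDLaw (leftMonad A) where
  hom :=
    { app := fun V => (α_ A.X A.X V).inv ≫ (β_ A.X A.X).hom ▷ V ≫ (α_ A.X A.X V).hom
      naturality := fun X Y f => by
        dsimp [leftMonad]
        calc _ = 𝟙 _ ⊗≫ ((A.X ⊗ A.X) ◁ f ≫ (β_ A.X A.X).hom ▷ Y) ⊗≫ 𝟙 _ := by monoidal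
          _ = _ := by rw [whisker_exchange]; monoidal }
  unit_left V := by
    dsimp [leftMonad]
    calc _ = 𝟙 _ ⊗≫ (MonObj.one ▷ A.X ≫ (β_ A.X A.X).hom) ▷ V ⊗≫ 𝟙 _ := by monoidal
      _ = _ := by rw [BraidedCategory.braiding_naturality_left, braiding_tensorUnit_left]; monoidal
  unit_right V := by
    dsimp [leftMonad]
    calc _ = 𝟙 _ ⊗≫ (A.X ◁ MonObj.one ≫ (β_ A.X A.X).hom) ▷ V ⊗≫ 𝟙 _ := by monoidal
      _ = _ := by rw [BraidedCategory.braiding_naturality_right, braiding_tensorUnit_right]; monoidal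
  mul_left V := by
    dsimp [leftMonad]
    calc _ = 𝟙 _ ⊗≫ (MonObj.mul ▷ A.X ≫ (β_ A.X A.X).hom) ▷ V ⊗≫ 𝟙 _ := by monoidal
      _ = _ := by rw [BraidedCategory.braiding_naturality_left, BraidedCategory.braiding_tensor_left_hom]; monoidal
  mul_right V := by
    dsimp [leftMonad]
    calc _ = 𝟙 _ ⊗≫ (A.X ◁ MonObj.mul ≫ (β_ A.X A.X).hom) ▷ V ⊗≫ 𝟙 _ := by monoidal
      _ = _ := by rw [BraidedCategory.braiding_naturality_right, BraidedCategory.braiding_tensor_right_hom]; monoidal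
  yang_baxter V := by
    dsimp [leftMonad]
    symm
    calc _ = 𝟙 _ ⊗≫ ((β_ A.X A.X).hom ▷ A.X ⊗≫ A.X ◁ (β_ A.X A.X).hom ⊗≫ (β_ A.X A.X).hom ▷ A.X) ▷ V ⊗≫ 𝟙 _ := by monoidal
      _ = _ := by rw [BraidedCategory.yang_baxter']; monoidal

/-- The BD-law `V ⊗ τ` on the monad `- ⊗ A` given by the braiding. -/
def rightBDLaw (A : Mon C) : BDLaw (rightMonad A) where
  hom :=
    { app := fun V => (α_ V A.X A.X).hom ≫ V ◁ (β_ A.X A.X).hom ≫ (α_ V A.X A.X).inv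
      naturality := fun X Y f => by
        dsimp [rightMonad]
        calc _ = 𝟙 _ ⊗≫ (f ▷ (A.X ⊗ A.X) ≫ Y ◁ (β_ A.X A.X).hom) ⊗≫ 𝟙 _ := by monoidal
          _ = _ := by rw [← whisker_exchange]; monoidal }
  unit_left V := by
    dsimp [rightMonad]
    calc _ = 𝟙 _ ⊗≫ V ◁ (A.X ◁ MonObj.one ≫ (β_ A.X A.X).hom) ⊗≫ 𝟙 _ := by monoidal
      _ = _ := by rw [BraidedCategory.braiding_naturality_right, braiding_tensorUnit_right]; monoidal
  unit_right V := by
    dsimp [rightMonad]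
    calc _ = 𝟙 _ ⊗≫ V ◁ (MonObj.one ▷ A.X ≫ (β_ A.X A.X).hom) ⊗≫ 𝟙 _ := by monoidal
      _ = _ := by rw [BraidedCategory.braiding_naturality_left, braiding_tensorUnit_left]; monoidal
  mul_left V := by
    dsimp [rightMonad]
    calc _ = 𝟙 _ ⊗≫ V ◁ (A.X ◁ MonObj.mul ≫ (β_ A.X A.X).hom) ⊗≫ 𝟙 _ := by monoidal
      _ = _ := by rw [BraidedCategory.braiding_naturality_right, BraidedCategory.braiding_tensor_right_hom]; monoidal
  mul_right V := by
    dsimp [rightMonad]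
    calc _ = 𝟙 _ ⊗≫ V ◁ (MonObj.mul ▷ A.X ≫ (β_ A.X A.X).hom) ⊗≫ 𝟙 _ := by monoidal
      _ = _ := by rw [BraidedCategory.braiding_naturality_left, BraidedCategory.braiding_tensor_left_hom]; monoidal
  yang_baxter V := by
    dsimp [rightMonad]
    calc _ = 𝟙 _ ⊗≫ V ◁ ((β_ A.X A.X).hom ▷ A.X ⊗≫ A.X ◁ (β_ A.X A.X).hom ⊗≫ (β_ A.X A.X).hom ▷ A.X) ⊗≫ 𝟙 _ := by monoidal
      _ = _ := by rw [BraidedCategory.yang_baxter']; monoidal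

/-- `A` is left Azumaya if the monad `A ⊗ -`, with the BD-law given by the braiding,
is Azumaya. -/
def IsLeftAzumaya (A : Mon C) : Prop := (leftBDLaw A).IsAzumaya

/-- `A` is right Azumaya if the monad `- ⊗ A`, with the BD-law given by the braiding,
is Azumaya. -/
def IsRightAzumaya (A : Mon C) : Prop := (rightBDLaw A).IsAzumaya

/-- The composite `A ⊗ A ⟶ D ⊗ A ⊗ A ⊗ A ⟶ D ⊗ A ⊗ A ⟶ D ⊗ A ⊗ A ⟶ D ⊗ A` of `db' ⊗ A ⊗ A`,
`D ⊗ m ⊗ A`, `D ⊗ τ` and `D ⊗ m`, for `D` right adjoint to `A`. -/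
def chi (A : Mon C) (D : C) [ExactPairing D A.X] : A.X ⊗ A.X ⟶ D ⊗ A.X :=
  (λ_ (A.X ⊗ A.X)).inv ≫ η_ D A.X ▷ (A.X ⊗ A.X) ≫ (α_ D A.X (A.X ⊗ A.X)).hom ≫
    D ◁ ((α_ A.X A.X A.X).inv ≫ MonObj.mul ▷ A.X) ≫
    D ◁ (β_ A.X A.X).hom ≫ D ◁ MonObj.mul

/-- The composite `A ⊗ A ⟶ D ⊗ A ⊗ A ⊗ A ⟶ D ⊗ A ⊗ A ⊗ A ⟶ D ⊗ A ⊗ A ⟶ D ⊗ A` of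
`db' ⊗ A ⊗ A`, `D ⊗ τ ⊗ A`, `D ⊗ m ⊗ A` and `D ⊗ m`, for `D` right adjoint to `A`. -/
def chi₁ (A : Mon C) (D : C) [ExactPairing D A.X] : A.X ⊗ A.X ⟶ D ⊗ A.X :=
  (λ_ (A.X ⊗ A.X)).inv ≫ η_ D A.X ▷ (A.X ⊗ A.X) ≫ (α_ D A.X (A.X ⊗ A.X)).hom ≫
    D ◁ ((α_ A.X A.X A.X).inv ≫ (β_ A.X A.X).hom ▷ A.X ≫ MonObj.mul ▷ A.X) ≫
    D ◁ MonObj.mul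

end Braided

end AzumayaTheory

open AzumayaTheory

/-! Every condition reduces to two facts: `A ⊗ -` (equivalently, through the braiding, `- ⊗ A`) is
conservative, and the mate of a bimodule action is invertible for some dual of `A`.

For a left `B`-module `V`, the functor `X ↦ V ⊗ X` into `B`-modules is an equivalence exactly when
`V` is faithfully Galois. If the mate `B ⟶ V ⊗ W` is invertible, it identifies `B ⊗ -` with the
monad of `W ⊗ - ⊣ V ⊗ -`. The functor `V ⊗ -` is also a left adjoint, because the braiding turns
left duals into right duals, so Beck's theorem applies (`leftComparison_isEquivalence`). Conversely,
an equivalence produces `W` with `B ≅ V ⊗ W`, and its fullness and faithfulness produce evaluation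
and the triangle identities (`exists_exactPairing_isIso_leftMateHom`). With `B = A ⊗ A^τ` this is
(a) ⇔ (b); reversing the tensor product gives (e) ⇔ (f).

In the presence of duals, the monadicity and comonadicity conditions both amount to conservativity.
Moreover `chi₁` is the mate of the right enveloping action, and `chi` is `chi₁` preceded by the
braiding. So (c), (d) and (e) agree.

The bridge from left to right is a statement about monads, `BDLaw.IsAzumaya.isIso_coinducedMate`:
for an Azumaya monad `F` with invertible law and right adjoint `R`, the canonical map `FFX ⟶ RFX` is
invertible. For `F = A ⊗ -` and `X` the unit object this map is `chi`, whence (b) ⇒ (e); the same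
implication for the reversed tensor product gives (e) ⇒ (b). -/

namespace AzumayaTheory

/-! ### Beck's theorem for conservative functors with enough adjoints. -/

section Monadicity

variable {C D : Type*} [Category.{v} C] [Category.{v} D]

/-- A conservative right adjoint preserving colimits is monadic if coequalizers exist. -/
@[reducible]
def monadicOfIsLeftAdjoint [Limits.HasCoequalizers D] {F : C ⥤ D} {G : D ⥤ C} (adj : F ⊣ G)
    [G.IsLeftAdjoint] [G.ReflectsIsomorphisms] : MonadicRightAdjoint G :=
  have : Limits.PreservesColimitsOfSize.{0, 0} G :=
    (Adjunction.ofIsLeftAdjoint G).leftAdjoint_preservesColimits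
  have : Monad.PreservesColimitOfIsReflexivePair G := ⟨fun _ _ _ _ _ => inferInstance⟩
  Monad.monadicOfHasPreservesReflexiveCoequalizersOfReflectsIsomorphisms adj

theorem reflectsIsomorphisms_of_monadic (G : D ⥤ C) [MonadicRightAdjoint G] :
    G.ReflectsIsomorphisms :=
  inferInstanceAs (Monad.comparison (monadicAdjunction G) ⋙ Monad.forget _).ReflectsIsomorphisms

theorem reflectsIsomorphisms_of_comonadic (F : C ⥤ D) [ComonadicLeftAdjoint F] :
    F.ReflectsIsomorphisms :=
  inferInstanceAs
    (Comonad.comparison (comonadicAdjunction F) ⋙ Comonad.forget _).ReflectsIsomorphisms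

/-- A conservative left adjoint preserving limits is comonadic if equalizers exist. -/
@[reducible]
def comonadicOfPreservesLimits [Limits.HasEqualizers C] {F : C ⥤ D} {G : D ⥤ C} (adj : F ⊣ G)
    [Limits.PreservesLimitsOfShape Limits.WalkingParallelPair F] [F.ReflectsIsomorphisms] :
    ComonadicLeftAdjoint F :=
  have : Comonad.PreservesLimitOfIsCoreflexivePair F := ⟨fun _ _ _ _ _ => inferInstance⟩
  Comonad.comonadicOfHasPreservesCoreflexiveEqualizersOfReflectsIsomorphisms adj

end Monadicity

/-! ### Galois modules and the comparison functor `X ↦ V ⊗ X`. -/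

section ModuleComparison

variable {C : Type u} [Category.{v} C] [MonoidalCategory C]

/-- The action of an algebra on a left module, as a morphism out of the tensor product. -/
def leftAct {B : Mon C} (V : Mod C B.X) : B.X ⊗ V.X ⟶ V.X :=
  (ModObj.smul (M := B.X) (X := V.X) : B.X ⊗ V.X ⟶ V.X)

theorem one_leftAct {B : Mon C} (V : Mod C B.X) :
    MonObj.one ▷ V.X ≫ leftAct V = (λ_ V.X).hom := by
  have h := ModObj.one_smul (M := B.X) V.X
  change MonObj.one ▷ V.X ≫ leftAct V = (λ_ V.X).hom at h
  exact h

theorem mul_leftAct {B : Mon C} (V : Mod C B.X) :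
    MonObj.mul ▷ V.X ≫ leftAct V = (α_ B.X B.X V.X).hom ≫ B.X ◁ leftAct V ≫ leftAct V := by
  have h := ModObj.mul_smul (M := B.X) V.X
  change MonObj.mul ▷ V.X ≫ leftAct V =
    (α_ B.X B.X V.X).hom ≫ B.X ◁ leftAct V ≫ leftAct V at h
  exact h

/-- The mate `B ⟶ V ⊗ W` of the action, as a morphism into the underlying object of the
algebra `V ⊗ W`. -/
def leftMateHom {B : Mon C} (V : Mod C B.X) (W : C) [ExactPairing V.X W] : B.X ⟶ V.X ⊗ W :=
  (ρ_ B.X).inv ≫ B.X ◁ η_ V.X W ≫ (α_ B.X V.X W).inv ≫ leftAct V ▷ W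

theorem one_leftMateHom {B : Mon C} (V : Mod C B.X) (W : C) [ExactPairing V.X W] :
    MonObj.one ≫ leftMateHom V W = η_ V.X W := by
  rw [leftMateHom]
  calc _ = 𝟙 _ ⊗≫ (MonObj.one ▷ (𝟙_ C) ≫ B.X ◁ η_ V.X W) ⊗≫ leftAct V ▷ W := by monoidal
    _ = 𝟙 _ ⊗≫ η_ V.X W ⊗≫ (MonObj.one ▷ V.X ≫ leftAct V) ▷ W := by
      rw [← whisker_exchange]; monoidal
    _ = _ := by rw [one_leftAct]; monoidal

/-- The action is recovered from its mate by evaluation. -/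
theorem leftMateHom_evaluation {B : Mon C} (V : Mod C B.X) (W : C) [ExactPairing V.X W] :
    leftMateHom V W ▷ V.X ⊗≫ V.X ◁ ε_ V.X W ⊗≫ 𝟙 V.X = leftAct V := by
  rw [leftMateHom]
  calc _ = 𝟙 _ ⊗≫ B.X ◁ η_ V.X W ▷ V.X ⊗≫
          (leftAct V ▷ (W ⊗ V.X) ≫ V.X ◁ ε_ V.X W) ⊗≫ 𝟙 _ := by monoidal
    _ = 𝟙 _ ⊗≫ B.X ◁ (η_ V.X W ▷ V.X ⊗≫ V.X ◁ ε_ V.X W) ⊗≫ leftAct V := by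
      rw [← whisker_exchange]; monoidal
    _ = _ := by rw [ExactPairing.evaluation_coevaluation'']; monoidal

/-- Acting by a product is acting twice; writing the outer action as its mate followed by evaluation
turns this into the product of `V ⊗ W`. -/
theorem mul_leftMateHom {B : Mon C} (V : Mod C B.X) (W : C) [ExactPairing V.X W] :
    MonObj.mul ≫ leftMateHom V W = leftMateHom V W ▷ B.X ≫ (V.X ⊗ W) ◁ leftMateHom V W ⊗≫
      V.X ◁ ε_ V.X W ▷ W ⊗≫ 𝟙 (V.X ⊗ W) := by
  calc _ = 𝟙 _ ⊗≫ (MonObj.mul ▷ (𝟙_ C) ≫ B.X ◁ η_ V.X W) ⊗≫ leftAct V ▷ W := by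
        rw [leftMateHom]; monoidal
    _ = 𝟙 _ ⊗≫ (B.X ⊗ B.X) ◁ η_ V.X W ⊗≫ (MonObj.mul ▷ V.X ≫ leftAct V) ▷ W := by
      rw [← whisker_exchange]; monoidal
    _ = 𝟙 _ ⊗≫ B.X ◁ leftMateHom V W ⊗≫ leftAct V ▷ W := by
      rw [mul_leftAct, leftMateHom]; monoidal
    _ = 𝟙 _ ⊗≫ (B.X ◁ leftMateHom V W ≫ leftMateHom V W ▷ (V.X ⊗ W)) ⊗≫
          V.X ◁ ε_ V.X W ▷ W ⊗≫ 𝟙 _ := by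
      conv_lhs => rw [← leftMateHom_evaluation V W]
      monoidal
    _ = _ := by rw [whisker_exchange]; monoidal

/-- The algebra condition in the Galois property is automatic, so only invertibility of the mate has
to be followed. -/
theorem leftMate_isMonHom {B : Mon C} (V : Mod C B.X) (W : C) [ExactPairing V.X W] :
    IsMonHom (leftMate V W) where
  one_hom := one_leftMateHom V W
  mul_hom := by
    change MonObj.mul ≫ leftMateHom V W = (leftMateHom V W ⊗ₘ leftMateHom V W) ≫
      (α_ V.X W (V.X ⊗ W)).hom ≫ V.X ◁ ((α_ W V.X W).inv ≫ ε_ V.X W ▷ W ≫ (λ_ W).hom)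
    rw [mul_leftMateHom, MonoidalCategory.tensorHom_def]
    monoidal

/-- The functor `X ↦ V ⊗ X` from the base category to the modules over the monad `B ⊗ -`,
for a left `B`-module `V`. -/
def leftComparison {B : Mon C} (V : Mod C B.X) : C ⥤ (leftMonad B).Algebra where
  obj X :=
    { A := V.X ⊗ X
      a := (α_ B.X V.X X).inv ≫ leftAct V ▷ X
      unit := by
        dsimp [leftMonad]
        calc _ = 𝟙 _ ⊗≫ (MonObj.one ▷ V.X ≫ leftAct V) ▷ X := by monoidal
          _ = _ := by rw [one_leftAct]; monoidal
      assoc := by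
        dsimp [leftMonad]
        calc _ = 𝟙 _ ⊗≫ (MonObj.mul ▷ V.X ≫ leftAct V) ▷ X := by monoidal
          _ = _ := by rw [mul_leftAct]; monoidal }
  map {X Y} f :=
    { f := V.X ◁ f
      h := by
        dsimp [leftMonad]
        calc _ = 𝟙 _ ⊗≫ ((B.X ⊗ V.X) ◁ f ≫ leftAct V ▷ Y) := by monoidal
          _ = _ := by rw [whisker_exchange]; monoidal }
  map_id X := by ext; simp
  map_comp f g := by ext; simp

variable {B : Mon C} (V : Mod C B.X) (W : C) [ExactPairing V.X W]

/-- If the mate of the action is invertible, the monad `B ⊗ -` is isomorphic to the monad induced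
by the adjunction `W ⊗ - ⊣ V ⊗ -`. -/
noncomputable def leftMonadIsoOfMate [IsIso (leftMateHom V W)] :
    leftMonad B ≅ (tensorLeftAdjunction V.X W).toMonad :=
  MonadIso.mk (M := leftMonad B) (N := (tensorLeftAdjunction V.X W).toMonad)
    (NatIso.ofComponents
      (fun X => whiskerRightIso (asIso (leftMateHom V W)) X ≪≫ α_ V.X W X)
      (fun {X Y} f => by
        change B.X ◁ f ≫ leftMateHom V W ▷ Y ≫ (α_ V.X W Y).hom =
          (leftMateHom V W ▷ X ≫ (α_ V.X W X).hom) ≫ V.X ◁ W ◁ f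
        rw [whisker_exchange_assoc]
        simp))
    (fun X => by
      change ((λ_ X).inv ≫ MonObj.one ▷ X) ≫ leftMateHom V W ▷ X ≫ (α_ V.X W X).hom =
        (λ_ X).inv ≫ η_ V.X W ▷ X ≫ (α_ V.X W X).hom ≫ V.X ◁ 𝟙 (W ⊗ X)
      rw [Category.assoc, ← comp_whiskerRight_assoc, one_leftMateHom]
      simp)
    (fun X => by
      change ((α_ B.X B.X X).inv ≫ MonObj.mul ▷ X) ≫ leftMateHom V W ▷ X ≫ (α_ V.X W X).hom =
        (B.X ◁ (leftMateHom V W ▷ X ≫ (α_ V.X W X).hom) ≫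
          leftMateHom V W ▷ (V.X ⊗ W ⊗ X) ≫ (α_ V.X W (V.X ⊗ W ⊗ X)).hom) ≫
          V.X ◁ (W ◁ 𝟙 (V.X ⊗ W ⊗ X) ≫ (α_ W V.X (W ⊗ X)).inv ≫ ε_ V.X W ▷ (W ⊗ X) ≫
            (λ_ (W ⊗ X)).hom)
      calc _ = 𝟙 _ ⊗≫ (MonObj.mul ≫ leftMateHom V W) ▷ X ⊗≫ 𝟙 _ := by monoidal
        _ = 𝟙 _ ⊗≫ (leftMateHom V W ▷ B.X ≫ (V.X ⊗ W) ◁ leftMateHom V W) ▷ X ⊗≫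
          V.X ◁ ε_ V.X W ▷ W ▷ X ⊗≫ 𝟙 _ := by rw [mul_leftMateHom]; monoidal
        _ = _ := by rw [← whisker_exchange]; monoidal)

/-- Under `leftMonadIsoOfMate`, the comparison functor of the adjunction `W ⊗ - ⊣ V ⊗ -`
becomes `leftComparison V`. -/
noncomputable def comparisonIsoLeftComparison [IsIso (leftMateHom V W)] :
    Monad.comparison (tensorLeftAdjunction V.X W) ⋙
      Monad.algebraFunctorOfMonadHom (leftMonadIsoOfMate V W).hom ≅ leftComparison V :=
  NatIso.ofComponents
    (fun X => Monad.Algebra.isoMk (Iso.refl (V.X ⊗ X)) (by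
      change B.X ◁ 𝟙 (V.X ⊗ X) ≫ (α_ B.X V.X X).inv ≫ leftAct V ▷ X =
        ((leftMateHom V W ▷ (V.X ⊗ X) ≫ (α_ V.X W (V.X ⊗ X)).hom) ≫
          V.X ◁ (W ◁ 𝟙 (V.X ⊗ X) ≫ (α_ W V.X X).inv ≫ ε_ V.X W ▷ X ≫ (λ_ X).hom)) ≫
          𝟙 (V.X ⊗ X)
      rw [← leftMateHom_evaluation V W]
      monoidal))
    (fun {X Y} f => by
      ext
      change V.X ◁ f ≫ 𝟙 (V.X ⊗ Y) = 𝟙 (V.X ⊗ X) ≫ V.X ◁ f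
      simp)

/-- Beck's theorem for `W ⊗ - ⊣ V ⊗ -`, transported along the isomorphism of monads given by the
mate. -/
theorem leftComparison_isEquivalence [BraidedCategory C] [Limits.HasCoequalizers C]
    [IsIso (leftMateHom V W)] [(tensorLeft V.X).ReflectsIsomorphisms] :
    (leftComparison V).IsEquivalence := by
  -- The braiding makes `W` a dual on the other side as well, so `V ⊗ -` has a right adjoint and
  -- preserves coequalizers.
  let : ExactPairing W V.X := BraidedCategory.exactPairing_swap V.X W
  have : (tensorLeft V.X).IsLeftAdjoint := (tensorLeftAdjunction W V.X).isLeftAdjoint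
  have := (monadicOfIsLeftAdjoint (tensorLeftAdjunction V.X W)).eqv
  have : (Monad.algebraFunctorOfMonadHom (leftMonadIsoOfMate V W).hom).IsEquivalence :=
    (Monad.algebraEquivOfIsoMonads (leftMonadIsoOfMate V W)).isEquivalence_inverse
  exact Functor.isEquivalence_of_iso (comparisonIsoLeftComparison V W)

section Converse

variable [(leftComparison V).IsEquivalence]

theorem tensorLeft_reflectsIsomorphisms : (tensorLeft V.X).ReflectsIsomorphisms :=
  inferInstanceAs (leftComparison V ⋙ (leftMonad B).forget).ReflectsIsomorphisms

variable {V}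

/-- Fullness of the comparison functor, in terms of tensor products. -/
theorem exists_whiskerLeft_eq {X Y : C} (f : V.X ⊗ X ⟶ V.X ⊗ Y)
    (hf : B.X ◁ f ≫ (α_ B.X V.X Y).inv ≫ leftAct V ▷ Y =
      ((α_ B.X V.X X).inv ≫ leftAct V ▷ X) ≫ f) : ∃ g : X ⟶ Y, V.X ◁ g = f := by
  obtain ⟨g, hg⟩ := (leftComparison V).map_surjective
    (X := X) (Y := Y) { f := f, h := hf }
  exact ⟨g, congrArg Monad.Algebra.Hom.f hg⟩

theorem whiskerLeft_injective {X Y : C} {f g : X ⟶ Y} (h : V.X ◁ f = V.X ◁ g) : f = g :=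
  (leftComparison V).map_injective (Monad.Algebra.Hom.ext h)

variable (V) in
-- Essential surjectivity at the free module on the unit object, which is `B` itself; its preimage
-- is the candidate dual.
theorem exists_iso_tensor : ∃ (W : C) (φ : B.X ≅ V.X ⊗ W),
    MonObj.mul ≫ φ.hom = B.X ◁ φ.hom ≫ (α_ B.X V.X W).inv ≫ leftAct V ▷ W := by
  let M := (leftMonad B).free.obj (𝟙_ C)
  let e := (leftComparison V).objObjPreimageIso M
  let e' : V.X ⊗ (leftComparison V).objPreimage M ≅ B.X ⊗ 𝟙_ C :=
    (leftMonad B).forget.mapIso e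
  have he := e.inv.h
  change B.X ◁ e'.inv ≫ (α_ B.X V.X _).inv ≫ leftAct V ▷ _ =
    ((α_ B.X B.X (𝟙_ C)).inv ≫ MonObj.mul ▷ 𝟙_ C) ≫ e'.inv at he
  refine ⟨(leftComparison V).objPreimage M, (ρ_ B.X).symm ≪≫ e'.symm, ?_⟩
  simp [he]

/-- If `leftComparison V` is an equivalence, then `V` has a left dual, and the mate of the action
is invertible. -/
theorem exists_exactPairing_isIso_leftMateHom :
    ∃ (W : C) (_ : ExactPairing V.X W), IsIso (leftMateHom V W) := by
  obtain ⟨W, φ, hφ⟩ := exists_iso_tensor V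
  -- The map `V ⊗ W ⊗ V ≅ B ⊗ V ⟶ V` is `B`-linear, so by fullness it is `V ⊗ ev`.
  obtain ⟨ev, hev⟩ := exists_whiskerLeft_eq (V := V) (X := W ⊗ V.X) (Y := 𝟙_ C)
    ((α_ V.X W V.X).inv ≫ φ.inv ▷ V.X ≫ leftAct V ≫ (ρ_ V.X).inv) (by
      have h : B.X ◁ φ.inv ≫ MonObj.mul =
          (α_ B.X V.X W).inv ≫ leftAct V ▷ W ≫ φ.inv := by
        rw [← cancel_mono φ.hom, Category.assoc, hφ]
        simp [← whiskerLeft_comp_assoc]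
      calc _ = 𝟙 _ ⊗≫ B.X ◁ φ.inv ▷ V.X ⊗≫ ((α_ B.X B.X V.X).hom ≫
              B.X ◁ leftAct V ≫ leftAct V) ≫ (ρ_ V.X).inv := by monoidal
        _ = 𝟙 _ ⊗≫ (B.X ◁ φ.inv ≫ MonObj.mul) ▷ V.X ⊗≫ leftAct V ≫ (ρ_ V.X).inv := by
          rw [← mul_leftAct]; monoidal
        _ = _ := by rw [h]; monoidal)
  have h1 : (MonObj.one ≫ φ.hom) ▷ V.X ≫ (α_ V.X W V.X).hom ≫ V.X ◁ ev =
      (λ_ V.X).hom ≫ (ρ_ V.X).inv := by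
    rw [hev, comp_whiskerRight]
    simp only [Category.assoc, Iso.hom_inv_id_assoc, hom_inv_whiskerRight_assoc]
    rw [reassoc_of% one_leftAct V]
  -- A linear map out of `B` is determined by its value at the unit, so `φ` is the mate once `φ` of
  -- the unit is taken as coevaluation.
  have hmate : (ρ_ B.X).inv ≫ B.X ◁ (MonObj.one ≫ φ.hom) ≫ (α_ B.X V.X W).inv ≫
      leftAct V ▷ W = φ.hom := by
    rw [whiskerLeft_comp, Category.assoc, ← hφ, ← Category.assoc (B.X ◁ _), MonObj.mul_one]
    simp
  let P : ExactPairing V.X W :=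
    { coevaluation' := MonObj.one ≫ φ.hom
      evaluation' := ev
      evaluation_coevaluation' := h1
      coevaluation_evaluation' := by
        -- By faithfulness this triangle may be tested after `V ⊗ -`, where `V ⊗ ev` is known
        -- explicitly.
        refine whiskerLeft_injective (V := V) ?_
        calc _ = 𝟙 _ ⊗≫ (V.X ⊗ W) ◁ (MonObj.one ≫ φ.hom) ⊗≫ (V.X ◁ ev) ▷ W ⊗≫ 𝟙 _ := by
              monoidal
          _ = 𝟙 _ ⊗≫ ((V.X ⊗ W) ◁ (MonObj.one ≫ φ.hom) ≫ φ.inv ▷ (V.X ⊗ W)) ⊗≫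
                leftAct V ▷ W ⊗≫ 𝟙 _ := by rw [hev]; monoidal
          _ = 𝟙 _ ⊗≫ φ.inv ⊗≫ ((ρ_ B.X).inv ≫ B.X ◁ (MonObj.one ≫ φ.hom) ≫
                (α_ B.X V.X W).inv ≫ leftAct V ▷ W) ⊗≫ 𝟙 _ := by
            rw [whisker_exchange]; monoidal
          _ = 𝟙 _ ⊗≫ (φ.inv ≫ φ.hom) ⊗≫ 𝟙 _ := by rw [hmate]; monoidal
          _ = _ := by rw [Iso.inv_hom_id]; monoidal }
  refine ⟨W, P, ?_⟩
  have : leftMateHom V W = φ.hom := hmate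
  rw [this]
  infer_instance

end Converse

end ModuleComparison

/-! ### Left Azumaya algebras and the enveloping algebra `A ⊗ A^τ`. -/

section LeftAzumaya

variable {C : Type u} [Category.{v} C] [MonoidalCategory C] [BraidedCategory C] (A : Mon C)

/-- The monad `F F^λ` of the braiding law is the monad of the enveloping algebra. -/
def compMonadIsoLeftMonad : (leftBDLaw A).oppositeLaw.compMonad ≅ leftMonad (leftEnv A) :=
  MonadIso.mk (M := (leftBDLaw A).oppositeLaw.compMonad) (N := leftMonad (leftEnv A))
    (NatIso.ofComponents (fun X => (α_ A.X A.X X).symm)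
      (fun {X Y} f => by
        change A.X ◁ A.X ◁ f ≫ (α_ A.X A.X Y).inv = (α_ A.X A.X X).inv ≫ (A.X ⊗ A.X) ◁ f
        simp))
    (fun X => by
      change (((λ_ X).inv ≫ MonObj.one ▷ X) ≫ (λ_ (A.X ⊗ X)).inv ≫ MonObj.one ▷ (A.X ⊗ X)) ≫
        (α_ A.X A.X X).inv =
          (λ_ X).inv ≫ ((λ_ (𝟙_ C)).inv ≫ (MonObj.one ⊗ₘ MonObj.one)) ▷ X
      rw [MonoidalCategory.tensorHom_def']
      monoidal)
    (fun X => by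
      change (A.X ◁ ((α_ A.X A.X (A.X ⊗ X)).inv ≫ (β_ A.X A.X).hom ▷ (A.X ⊗ X) ≫
          (α_ A.X A.X (A.X ⊗ X)).hom) ≫
        A.X ◁ A.X ◁ (((α_ A.X A.X X).inv ≫ (β_ A.X A.X).hom ▷ X ≫ (α_ A.X A.X X).hom) ≫
          (α_ A.X A.X X).inv ≫ MonObj.mul ▷ X) ≫
        (α_ A.X A.X (A.X ⊗ X)).inv ≫ MonObj.mul ▷ (A.X ⊗ X)) ≫ (α_ A.X A.X X).inv =
        (A.X ◁ A.X ◁ (α_ A.X A.X X).inv ≫ (α_ A.X A.X ((A.X ⊗ A.X) ⊗ X)).inv) ≫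
          (α_ (A.X ⊗ A.X) (A.X ⊗ A.X) X).inv ≫ (tensorμ A.X A.X A.X A.X ≫
            (MonObj.mul ⊗ₘ ((β_ A.X A.X).hom ≫ MonObj.mul))) ▷ X
      rw [MonoidalCategory.tensorHom_def', tensorμ]
      monoidal)

/-- The two comparison functors differ only by the equivalence of module categories that
reassociates `A ⊗ (A ⊗ X)`. -/
theorem comparison_isEquivalence_iff_leftComparison :
    (leftBDLaw A).comparison.IsEquivalence ↔ (leftComparison (leftEnvModule A)).IsEquivalence := by
  have : (Monad.algebraFunctorOfMonadHom (compMonadIsoLeftMonad A).hom).IsEquivalence :=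
    (Monad.algebraEquivOfIsoMonads (compMonadIsoLeftMonad A)).isEquivalence_inverse
  let e : leftComparison (leftEnvModule A) ⋙
      Monad.algebraFunctorOfMonadHom (compMonadIsoLeftMonad A).hom ≅ (leftBDLaw A).comparison :=
    NatIso.ofComponents
      (fun X => Monad.Algebra.isoMk (Iso.refl (A.X ⊗ X)) (by
        change A.X ◁ A.X ◁ 𝟙 (A.X ⊗ X) ≫ A.X ◁ ((α_ A.X A.X X).inv ≫ (β_ A.X A.X).hom ▷ X ≫
            (α_ A.X A.X X).hom) ≫
          A.X ◁ ((α_ A.X A.X X).inv ≫ MonObj.mul ▷ X) ≫ (α_ A.X A.X X).inv ≫ MonObj.mul ▷ X =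
          ((α_ A.X A.X (A.X ⊗ X)).inv ≫ (α_ (A.X ⊗ A.X) A.X X).inv ≫
            ((α_ A.X A.X A.X).hom ≫ A.X ◁ ((β_ A.X A.X).hom ≫ MonObj.mul) ≫ MonObj.mul) ▷ X) ≫
              𝟙 (A.X ⊗ X)
        monoidal))
      (fun {X Y} f => by
        ext
        change A.X ◁ f ≫ 𝟙 (A.X ⊗ Y) = 𝟙 (A.X ⊗ X) ≫ A.X ◁ f
        simp)
  refine ⟨fun h => ?_, fun h => Functor.isEquivalence_of_iso e⟩
  have := Functor.isEquivalence_of_iso e.symm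
  exact Functor.isEquivalence_of_comp_right _
    (Monad.algebraFunctorOfMonadHom (compMonadIsoLeftMonad A).hom)

theorem isLeftFaithfullyGalois_iff {C : Type u} [Category.{v} C] [MonoidalCategory C]
    {B : Mon C} (V : Mod C B.X) : IsLeftFaithfullyGalois V ↔
      (∃ (W : C) (_ : ExactPairing V.X W), IsIso (leftMateHom V W)) ∧
        (tensorLeft V.X).ReflectsIsomorphisms :=
  and_congr_left fun _ =>
    ⟨fun ⟨W, P, h⟩ => ⟨W, P, h.2⟩, fun ⟨W, P, h⟩ => ⟨W, P, leftMate_isMonHom V W, h⟩⟩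

theorem isLeftAzumaya_iff_isLeftFaithfullyGalois [Limits.HasCoequalizers C] :
    IsLeftAzumaya A ↔ IsLeftFaithfullyGalois (leftEnvModule A) := by
  rw [isLeftFaithfullyGalois_iff]
  refine (comparison_isEquivalence_iff_leftComparison A).trans ⟨fun h => ?_, ?_⟩
  · exact ⟨exists_exactPairing_isIso_leftMateHom, tensorLeft_reflectsIsomorphisms _⟩
  · rintro ⟨⟨W, P, h⟩, h'⟩
    exact leftComparison_isEquivalence _ W

end LeftAzumaya

/-! ### Passage between left and right modules by reversing the tensor product. -/

section Reversal

open MonoidalOpposite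

variable {C : Type u} [Category.{v} C] [MonoidalCategory C]

/-- An algebra, regarded as an algebra in the category with the reversed tensor product. -/
def mopAlgebra (A : Mon C) : Mon Cᴹᵒᵖ := ⟨mop A.X⟩

/-- A right module, regarded as a left module in the category with the reversed tensor product. -/
def mopModule {B : Mon C} (V : RightModule B) : Mod Cᴹᵒᵖ (mopAlgebra B).X where
  X := mop V.X
  mod :=
    { smul := V.act.mop
      one_smul := congrArg Quiver.Hom.mop V.act_one
      mul_smul := congrArg Quiver.Hom.mop V.act_mul }

/-- An exact pairing, with the reversed tensor product. -/
@[reducible]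
def mopExactPairing (V W : C) [ExactPairing W V] : ExactPairing (mop V) (mop W) where
  coevaluation' := (η_ W V).mop
  evaluation' := (ε_ W V).mop
  evaluation_coevaluation' := congrArg Quiver.Hom.mop (ExactPairing.coevaluation_evaluation W V)
  coevaluation_evaluation' := congrArg Quiver.Hom.mop (ExactPairing.evaluation_coevaluation W V)

/-- An exact pairing in the category with the reversed tensor product, in the base category. -/
@[reducible]
def unmopExactPairing (V W : Cᴹᵒᵖ) [ExactPairing V W] : ExactPairing (unmop W) (unmop V) where
  coevaluation' := (η_ V W).unmop
  evaluation' := (ε_ V W).unmop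
  evaluation_coevaluation' := congrArg Quiver.Hom.unmop (ExactPairing.coevaluation_evaluation V W)
  coevaluation_evaluation' := congrArg Quiver.Hom.unmop (ExactPairing.evaluation_coevaluation V W)

/-- The mate `B ⟶ W ⊗ V` of the action, as a morphism into the underlying object of the
algebra `W ⊗ V`. -/
def rightMateHom {B : Mon C} (V : RightModule B) (W : C) [ExactPairing W V.X] : B.X ⟶ W ⊗ V.X :=
  (λ_ B.X).inv ≫ η_ W V.X ▷ B.X ≫ (α_ W V.X B.X).hom ≫ W ◁ V.act

theorem rightMate_isMonHom {B : Mon C} (V : RightModule B) (W : C) [ExactPairing W V.X] :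
    IsMonHom (rightMate V W) := by
  let P : ExactPairing (mopModule V).X (mop W) := mopExactPairing V.X W
  have h1 := congrArg Quiver.Hom.unmop (one_leftMateHom (mopModule V) (mop W))
  have h2 := (leftMate_isMonHom (mopModule V) (mop W)).mul_hom
  replace h2 := congrArg Quiver.Hom.unmop h2
  change MonObj.mul ≫ rightMateHom V W = (rightMateHom V W ⊗ₘ rightMateHom V W) ≫
    (α_ (W ⊗ V.X) W V.X).inv ≫ ((α_ W V.X W).hom ≫ W ◁ ε_ W V.X ≫ (ρ_ W).hom) ▷ V.X at h2
  refine ⟨h1, ?_⟩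
  change MonObj.mul ≫ rightMateHom V W = (rightMateHom V W ⊗ₘ rightMateHom V W) ≫
    (α_ W V.X (W ⊗ V.X)).hom ≫ W ◁ ((α_ V.X W V.X).inv ≫ ε_ W V.X ▷ V.X ≫ (λ_ V.X).hom)
  -- The transported multiplication evaluates the same inner pair as that of `W ⊗ V`; only the
  -- bracketing differs.
  rw [h2]
  monoidal

theorem isRightFaithfullyGalois_iff {B : Mon C} (V : RightModule B) :
    IsRightFaithfullyGalois V ↔
      (∃ (W : C) (_ : ExactPairing W V.X), IsIso (rightMateHom V W)) ∧
        (tensorRight V.X).ReflectsIsomorphisms :=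
  and_congr_left fun _ =>
    ⟨fun ⟨W, P, h⟩ => ⟨W, P, h.2⟩, fun ⟨W, P, h⟩ => ⟨W, P, rightMate_isMonHom V W, h⟩⟩

theorem isIso_mop_iff {C : Type u} [Category.{v} C] {X Y : C} (f : X ⟶ Y) : IsIso f.mop ↔ IsIso f :=
  ⟨fun _ => inferInstanceAs (IsIso f.mop.unmop), fun _ => inferInstance⟩

theorem tensorLeft_mop_reflectsIsomorphisms_iff (V : C) :
    (tensorLeft (mop V)).ReflectsIsomorphisms ↔ (tensorRight V).ReflectsIsomorphisms := by
  refine ⟨fun h => ⟨fun {X Y} f hf => ?_⟩, fun h => ⟨fun {X Y} f hf => ?_⟩⟩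
  · rw [← isIso_mop_iff]
    have : IsIso ((tensorLeft (mop V)).map f.mop) := (isIso_mop_iff _).2 hf
    exact isIso_of_reflects_iso f.mop (tensorLeft (mop V))
  · change IsIso f.unmop.mop
    rw [isIso_mop_iff]
    have : IsIso ((tensorRight V).map f.unmop) := (isIso_mop_iff _).1 hf
    exact isIso_of_reflects_iso f.unmop (tensorRight V)

theorem tensorRight_mop_reflectsIsomorphisms_iff (V : C) :
    (tensorRight (mop V)).ReflectsIsomorphisms ↔ (tensorLeft V).ReflectsIsomorphisms := by
  refine ⟨fun h => ⟨fun {X Y} f hf => ?_⟩, fun h => ⟨fun {X Y} f hf => ?_⟩⟩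
  · rw [← isIso_mop_iff]
    have : IsIso ((tensorRight (mop V)).map f.mop) := (isIso_mop_iff _).2 hf
    exact isIso_of_reflects_iso f.mop (tensorRight (mop V))
  · change IsIso f.unmop.mop
    rw [isIso_mop_iff]
    have : IsIso ((tensorLeft V).map f.unmop) := (isIso_mop_iff _).1 hf
    exact isIso_of_reflects_iso f.unmop (tensorLeft V)

variable [BraidedCategory C] (A : Mon C)

theorem isRightFaithfullyGalois_iff_mop : IsRightFaithfullyGalois (rightEnvModule A) ↔
    IsLeftFaithfullyGalois (leftEnvModule (mopAlgebra A)) := by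
  rw [isRightFaithfullyGalois_iff, isLeftFaithfullyGalois_iff]
  refine and_congr ⟨?_, ?_⟩ (tensorLeft_mop_reflectsIsomorphisms_iff A.X).symm
  · rintro ⟨W, P, h⟩
    let _ : ExactPairing W A.X := P
    exact ⟨mop W, mopExactPairing A.X W,
      (isIso_mop_iff (rightMateHom (rightEnvModule A) W)).2 h⟩
  · rintro ⟨W, P, h⟩
    let _ : ExactPairing (mop A.X) W := P
    exact ⟨unmop W, unmopExactPairing (mop A.X) W, (isIso_mop_iff _).1 h⟩

/-- The mirror image of one direction of `isRightFaithfullyGalois_iff_mop`; it brings the conclusion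
obtained in the reversed category back to the base category. -/
theorem IsLeftFaithfullyGalois.of_mop
    (h : IsRightFaithfullyGalois (rightEnvModule (mopAlgebra A))) :
    IsLeftFaithfullyGalois (leftEnvModule A) := by
  rw [isRightFaithfullyGalois_iff] at h
  rw [isLeftFaithfullyGalois_iff]
  obtain ⟨⟨W, P, hW⟩, hV⟩ := h
  let _ : ExactPairing W (mop A.X) := P
  exact ⟨⟨unmop W, unmopExactPairing W (mop A.X), (isIso_mop_iff _).1 hW⟩,
    (tensorRight_mop_reflectsIsomorphisms_iff A.X).1 hV⟩

end Reversal

/-! ### Right Azumaya algebras as left Azumaya algebras for the reversed tensor product. -/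

section RightAzumaya

open MonoidalOpposite

variable {C : Type u} [Category.{v} C] [MonoidalCategory C] [BraidedCategory C] (A : Mon C)

/-- Modules over the monad `X ↦ (X ⊗ A) ⊗ A` of a right Azumaya situation, regarded as modules
in the category with the reversed tensor product. -/
def mopCompAlgebra : (rightBDLaw A).oppositeLaw.compMonad.Algebra ⥤
    (leftBDLaw (mopAlgebra A)).oppositeLaw.compMonad.Algebra where
  obj M :=
    { A := mop M.A
      a := M.a.mop
      unit := congrArg Quiver.Hom.mop M.unit
      assoc := congrArg Quiver.Hom.mop M.assoc }
  map f :=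
    { f := f.f.mop
      h := congrArg Quiver.Hom.mop f.h }

/-- The inverse of `mopCompAlgebra`. -/
def unmopCompAlgebra : (leftBDLaw (mopAlgebra A)).oppositeLaw.compMonad.Algebra ⥤
    (rightBDLaw A).oppositeLaw.compMonad.Algebra where
  obj M :=
    { A := unmop M.A
      a := M.a.unmop
      unit := congrArg Quiver.Hom.unmop M.unit
      assoc := congrArg Quiver.Hom.unmop M.assoc }
  map f :=
    { f := f.f.unmop
      h := congrArg Quiver.Hom.unmop f.h }

instance : (mopCompAlgebra A).IsEquivalence :=
  (CategoryTheory.Equivalence.mk (mopCompAlgebra A) (unmopCompAlgebra A) (Iso.refl _)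
    (Iso.refl _)).isEquivalence_functor

/-- The two comparison functors form a square with two equivalences, and the square commutes
definitionally. -/
theorem isRightAzumaya_iff_mop : IsRightAzumaya A ↔ IsLeftAzumaya (mopAlgebra A) := by
  let e : (rightBDLaw A).comparison ⋙ mopCompAlgebra A ≅
    mopFunctor C ⋙ (leftBDLaw (mopAlgebra A)).comparison := Iso.refl _
  have : (mopFunctor C).IsEquivalence := (mopEquiv C).isEquivalence_functor
  constructor
  · intro (h : (rightBDLaw A).comparison.IsEquivalence)
    have := Functor.isEquivalence_of_iso e
    exact Functor.isEquivalence_of_comp_left (mopFunctor C) _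
  · intro (h : (leftBDLaw (mopAlgebra A)).comparison.IsEquivalence)
    have := Functor.isEquivalence_of_iso e.symm
    exact Functor.isEquivalence_of_comp_right _ (mopCompAlgebra A)

end RightAzumaya

/-! ### Monadicity and comonadicity as conservativity; the maps `chi` and `chi₁`. -/

section FreeComonadic

variable {C : Type u} [Category.{v} C] [MonoidalCategory C] (A : Mon C)

theorem free_reflectsIsomorphisms_iff :
    (leftMonad A).free.ReflectsIsomorphisms ↔ (tensorLeft A.X).ReflectsIsomorphisms := by
  refine ⟨fun h => ⟨fun {X Y} f hf => ?_⟩, fun h => ⟨fun {X Y} f hf => ?_⟩⟩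
  · have : IsIso ((leftMonad A).forget.map ((leftMonad A).free.map f)) := hf
    have := isIso_of_reflects_iso ((leftMonad A).free.map f) (leftMonad A).forget
    exact isIso_of_reflects_iso f (leftMonad A).free
  · have : IsIso ((tensorLeft A.X).map f) :=
      inferInstanceAs (IsIso ((leftMonad A).forget.map ((leftMonad A).free.map f)))
    exact isIso_of_reflects_iso f (tensorLeft A.X)

/-- A left dual makes `A ⊗ -` a right adjoint, hence limit-preserving; the forgetful functor
reflects limits, so the free functor preserves equalizers and the dual of Beck's theorem applies.
The criterion depends only on the underlying object, so it serves `A^τ` equally well. -/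
theorem nonempty_comonadic_free_iff [Limits.HasEqualizers C] (hA : IsFiniteObj A.X) :
    Nonempty (ComonadicLeftAdjoint (leftMonad A).free) ↔
      (tensorLeft A.X).ReflectsIsomorphisms := by
  rw [← free_reflectsIsomorphisms_iff]
  refine ⟨fun ⟨_⟩ => reflectsIsomorphisms_of_comonadic _, fun h => ?_⟩
  obtain ⟨W, ⟨P⟩⟩ := hA
  have : Limits.PreservesLimitsOfSize.{0, 0} (tensorLeft A.X) :=
    (tensorLeftAdjunction A.X W).rightAdjoint_preservesLimits
  have : Limits.PreservesLimitsOfShape Limits.WalkingParallelPair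
      ((leftMonad A).free ⋙ (leftMonad A).forget) :=
    inferInstanceAs (Limits.PreservesLimitsOfShape _ (tensorLeft A.X))
  have : Limits.PreservesLimitsOfShape Limits.WalkingParallelPair (leftMonad A).free :=
    Limits.preservesLimitsOfShape_of_reflects_of_preserves _ (leftMonad A).forget
  exact ⟨comonadicOfPreservesLimits (F := (leftMonad A).free) (leftMonad A).adj⟩

variable [BraidedCategory C]

theorem tensorRight_reflectsIsomorphisms_iff (V : C) :
    (tensorRight V).ReflectsIsomorphisms ↔ (tensorLeft V).ReflectsIsomorphisms :=
  ⟨fun _ => reflectsIsomorphisms_of_iso (BraidedCategory.tensorLeftIsoTensorRight V).symm,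
    fun _ => reflectsIsomorphisms_of_iso (BraidedCategory.tensorLeftIsoTensorRight V)⟩

/-- With the braiding, one dual makes `- ⊗ V` both a left and a right adjoint, so conservativity is
all that Beck's theorem still asks. -/
theorem nonempty_monadic_tensorRight_iff [Limits.HasCoequalizers C] (V : C) (hV : IsFiniteObj V) :
    Nonempty (MonadicRightAdjoint (tensorRight V)) ↔ (tensorRight V).ReflectsIsomorphisms := by
  refine ⟨fun ⟨_⟩ => reflectsIsomorphisms_of_monadic _, fun h => ?_⟩
  obtain ⟨W, ⟨P⟩⟩ := hV
  let Q : ExactPairing W V := BraidedCategory.exactPairing_swap V W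
  have := (tensorRightAdjunction V W).isLeftAdjoint
  exact ⟨monadicOfIsLeftAdjoint (tensorRightAdjunction W V)⟩

theorem isFiniteObj_of_exactPairing (V W : C) [ExactPairing W V] : IsFiniteObj V :=
  ⟨W, ⟨BraidedCategory.exactPairing_swap W V⟩⟩

theorem chi₁_eq (D : C) [ExactPairing D A.X] :
    letI : ExactPairing D (rightEnvModule A).X := ‹ExactPairing D A.X›
    chi₁ A D = rightMateHom (rightEnvModule A) D := by
  change (λ_ (A.X ⊗ A.X)).inv ≫ η_ D A.X ▷ (A.X ⊗ A.X) ≫ (α_ D A.X (A.X ⊗ A.X)).hom ≫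
    D ◁ ((α_ A.X A.X A.X).inv ≫ (β_ A.X A.X).hom ▷ A.X ≫ MonObj.mul ▷ A.X) ≫
    D ◁ MonObj.mul = (λ_ (A.X ⊗ A.X)).inv ≫ η_ D A.X ▷ (A.X ⊗ A.X) ≫
      (α_ D A.X (A.X ⊗ A.X)).hom ≫
      D ◁ ((α_ A.X A.X A.X).inv ≫ ((β_ A.X A.X).hom ≫ MonObj.mul) ▷ A.X ≫ MonObj.mul)
  monoidal

/-- The crossing after `m ⊗ A` splits into two crossings before it; the one on the last two factors
does not meet the coevaluation and slides to the front. -/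
theorem chi_eq (D : C) [ExactPairing D A.X] : chi A D = (β_ A.X A.X).hom ≫ chi₁ A D := by
  have h : MonObj.mul ▷ A.X ≫ (β_ A.X A.X).hom ≫ MonObj.mul =
      (α_ A.X A.X A.X).hom ≫ A.X ◁ (β_ A.X A.X).hom ≫ (α_ A.X A.X A.X).inv ≫
        (β_ A.X A.X).hom ▷ A.X ≫ MonObj.mul ▷ A.X ≫ MonObj.mul := by
    simp
  calc _ = 𝟙 _ ⊗≫ η_ D A.X ▷ (A.X ⊗ A.X) ⊗≫
        D ◁ (MonObj.mul ▷ A.X ≫ (β_ A.X A.X).hom ≫ MonObj.mul) := by rw [chi]; monoidal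
    _ = 𝟙 _ ⊗≫ (η_ D A.X ▷ (A.X ⊗ A.X) ≫ (D ⊗ A.X) ◁ (β_ A.X A.X).hom) ⊗≫
        D ◁ ((β_ A.X A.X).hom ▷ A.X ≫ MonObj.mul ▷ A.X ≫ MonObj.mul) := by rw [h]; monoidal
    _ = _ := by rw [← whisker_exchange, chi₁]; monoidal

end FreeComonadic

/-! ### Azumaya monads with a right adjoint. -/

section AzumayaMonads

variable {C : Type u} [Category.{v} C] {F : Monad C} (l : BDLaw F)

/-- A module over the monad `F F^λ`, from an `F`-module structure and an `F^λ`-module structure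
that are compatible with the law `λ`. -/
def BDLaw.pairAlgebra (M : F.Algebra) (q : F.obj M.A ⟶ M.A)
    (unit : F.η.app M.A ≫ q = 𝟙 M.A)
    (assoc : l.hom.app M.A ≫ F.μ.app M.A ≫ q = F.map q ≫ q)
    (comm : F.map M.a ≫ q = l.hom.app M.A ≫ F.map q ≫ M.a) :
    l.oppositeLaw.compMonad.Algebra where
  A := M.A
  a := F.map q ≫ M.a
  unit := by
    change (F.η.app M.A ≫ F.η.app (F.obj M.A)) ≫ F.map q ≫ M.a = 𝟙 M.A
    have h := F.η.naturality q
    dsimp at h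
    rw [Category.assoc, ← reassoc_of% h, M.unit, Category.comp_id, unit]
  assoc := by
    change (F.map (l.hom.app (F.obj M.A)) ≫ F.map (F.map (l.hom.app M.A ≫ F.μ.app M.A)) ≫
      F.μ.app (F.obj M.A)) ≫ F.map q ≫ M.a = F.map (F.map (F.map q ≫ M.a)) ≫ F.map q ≫ M.a
    have h1 := F.μ.naturality q
    have h2 := l.nat q
    dsimp at h1
    simp only [Category.assoc]
    rw [← reassoc_of% h1, M.assoc]
    simp only [← Functor.map_comp_assoc, Category.assoc]
    rw [assoc]
    congr 2
    rw [Functor.map_comp F.toFunctor (F.map q) M.a, Category.assoc, comm, reassoc_of% h2]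
    simp only [Functor.map_comp, Category.assoc]

/-- The opposite multiplication `m · λ`. -/
def BDLaw.opMul (X : C) : F.obj (F.obj X) ⟶ F.obj X := l.hom.app X ≫ F.μ.app X

theorem BDLaw.opMul_assoc (X : C) :
    F.map (l.opMul X) ≫ l.opMul X = l.opMul (F.obj X) ≫ l.opMul X :=
  l.oppositeMonad.assoc X

theorem BDLaw.unit_opMul (X : C) : F.η.app (F.obj X) ≫ l.opMul X = 𝟙 (F.obj X) :=
  l.oppositeMonad.left_unit X

theorem BDLaw.map_unit_opMul (X : C) : F.map (F.η.app X) ≫ l.opMul X = 𝟙 (F.obj X) :=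
  l.oppositeMonad.right_unit X

/-- Restriction of an `F F^λ`-linear map along the unit of the inner factor `F^λ`. -/
theorem BDLaw.map_comp_left_of_linear {X : C} {M : F.Algebra} {q : F.obj M.A ⟶ M.A}
    (unit : F.η.app M.A ≫ q = 𝟙 M.A) {f : F.obj X ⟶ M.A}
    (h : F.map (F.map f) ≫ F.map q ≫ M.a = F.map (l.opMul X) ≫ F.μ.app X ≫ f) :
    F.map f ≫ M.a = F.μ.app X ≫ f := by
  have h1 := congrArg (F.map ·) (F.η.naturality f)
  have h2 := congrArg (F.map ·) (l.unit_opMul X)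
  have h3 := congrArg (F.map ·) unit
  dsimp at h1 h2 h3
  rw [Functor.map_comp, Functor.map_comp] at h1
  rw [Functor.map_comp, CategoryTheory.Functor.map_id] at h2 h3
  calc F.map f ≫ M.a = F.map f ≫ F.map (F.η.app M.A) ≫ F.map q ≫ M.a := by
        rw [reassoc_of% h3]
    _ = F.map (F.η.app (F.obj X)) ≫ F.map (F.map f) ≫ F.map q ≫ M.a := by
        rw [reassoc_of% h1]
    _ = F.μ.app X ≫ f := by rw [h, reassoc_of% h2]

/-- Restriction along the unit of the outer factor `F`. -/
theorem BDLaw.map_comp_right_of_linear {X : C} {M : F.Algebra} {q : F.obj M.A ⟶ M.A}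
    {f : F.obj X ⟶ M.A}
    (h : F.map (F.map f) ≫ F.map q ≫ M.a = F.map (l.opMul X) ≫ F.μ.app X ≫ f) :
    F.map f ≫ q = l.opMul X ≫ f := by
  have h1 := F.η.naturality (F.map f)
  have h2 := F.η.naturality q
  have h3 := F.η.naturality (l.opMul X)
  dsimp at h1 h2 h3
  calc F.map f ≫ q = F.map f ≫ F.η.app (F.obj M.A) ≫ F.map q ≫ M.a := by
        rw [← reassoc_of% h2, M.unit, Category.comp_id]
    _ = F.η.app (F.obj (F.obj X)) ≫ F.map (F.map f) ≫ F.map q ≫ M.a := by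
        rw [← reassoc_of% h1]
    _ = l.opMul X ≫ f := by
        rw [h, ← reassoc_of% h3, reassoc_of% F.left_unit]

/-- A morphism from a comparison module that is compatible with both actions. -/
def BDLaw.homPairAlgebra {X : C} {M : F.Algebra} {q : F.obj M.A ⟶ M.A} {unit}
    {assoc} {comm} (f : F.obj X ⟶ M.A) (hp : F.map f ≫ M.a = F.μ.app X ≫ f)
    (hq : F.map f ≫ q = l.hom.app X ≫ F.μ.app X ≫ f) :
    l.comparison.obj X ⟶ l.pairAlgebra M q unit assoc comm where
  f := f
  h := by
    change F.map (F.map f) ≫ F.map q ≫ M.a =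
      (F.map (l.hom.app X) ≫ F.map (F.μ.app X) ≫ F.μ.app X) ≫ f
    rw [← Functor.map_comp_assoc, hq]
    simp [hp]

variable {R : C ⥤ C} (adj : F.toFunctor ⊣ R)

/-- Every identity between maps into `R Z` below is checked on transposes. -/
theorem map_comp_counit_injective {Y Z : C} {f g : Y ⟶ R.obj Z}
    (h : F.map f ≫ adj.counit.app Z = F.map g ≫ adj.counit.app Z) : f = g :=
  (adj.homEquiv Y Z).symm.injective (by simpa [Adjunction.homEquiv_counit] using h)

theorem map_homEquiv_counit {Y Z : C} (f : F.obj Y ⟶ Z) :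
    F.map (adj.homEquiv Y Z f) ≫ adj.counit.app Z = f := by
  exact (adj.homEquiv_counit _ _ _).symm.trans (Equiv.symm_apply_apply _ f)

/-- The action of `F` on `R Y`, for `R` right adjoint to `F`. -/
def coinducedAction (Y : C) : F.obj (R.obj Y) ⟶ R.obj Y :=
  adj.homEquiv _ _ (F.μ.app (R.obj Y) ≫ adj.counit.app Y)

theorem map_coinducedAction_counit (X : C) :
    F.map (coinducedAction adj X) ≫ adj.counit.app X =
      F.μ.app (R.obj X) ≫ adj.counit.app X :=
  map_homEquiv_counit adj _

/-- `R Y`, for `R` right adjoint to `F`, as an `F`-module. -/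
def coinducedAlgebra (Y : C) : F.Algebra where
  A := R.obj Y
  a := coinducedAction adj Y
  unit := by
    apply map_comp_counit_injective adj
    rw [Functor.map_comp, Category.assoc, map_coinducedAction_counit]
    simp
  assoc := by
    apply map_comp_counit_injective adj
    have h := F.μ.naturality (coinducedAction adj Y)
    dsimp at h
    rw [Functor.map_comp, Functor.map_comp, Category.assoc, Category.assoc,
      map_coinducedAction_counit, reassoc_of% h, map_coinducedAction_counit, reassoc_of% F.assoc]

/-- The morphism `FFX ⟶ RFX` obtained from the multiplication `m^λ · m`. -/
def BDLaw.coinducedMate (X : C) : F.obj (F.obj X) ⟶ R.obj (F.obj X) :=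
  adj.homEquiv (F.obj (F.obj X)) (F.obj X) (F.μ.app (F.obj X) ≫ l.opMul X)

theorem BDLaw.map_coinducedMate_counit (X : C) :
    F.map (l.coinducedMate adj X) ≫ adj.counit.app (F.obj X) =
      F.μ.app (F.obj X) ≫ l.opMul X :=
  map_homEquiv_counit adj _

theorem BDLaw.map_coinducedMate_left (X : C) :
    F.map (l.coinducedMate adj X) ≫ coinducedAction adj (F.obj X) =
      F.μ.app (F.obj X) ≫ l.coinducedMate adj X := by
  apply map_comp_counit_injective adj
  have h := F.μ.naturality (l.coinducedMate adj X)
  dsimp at h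
  rw [Functor.map_comp, Category.assoc, map_coinducedAction_counit, reassoc_of% h,
    Functor.map_comp, Category.assoc, l.map_coinducedMate_counit, reassoc_of% F.assoc]

/-- Both multiplications collapse on units. This becomes one of the two inverse laws in
`BDLaw.IsAzumaya.isIso_coinducedMate`. -/
theorem BDLaw.unit_coinducedMate (X : C) :
    F.η.app (F.obj X) ≫ l.coinducedMate adj X ≫ F.η.app (R.obj (F.obj X)) ≫
      adj.counit.app (F.obj X) = 𝟙 (F.obj X) := by
  have h1 := F.η.naturality (l.coinducedMate adj X)
  dsimp at h1
  rw [reassoc_of% h1, l.map_coinducedMate_counit, reassoc_of% F.left_unit, l.unit_opMul]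

variable [∀ X, IsIso (l.hom.app X)]

/-- The laws for `λ⁻¹` are needed because `F^λ` acts on `R F X` through `λ⁻¹`. -/
theorem BDLaw.map_mul_inv (X : C) : F.map (F.μ.app X) ≫ inv (l.hom.app X) =
    inv (l.hom.app (F.obj X)) ≫ F.map (inv (l.hom.app X)) ≫ F.μ.app (F.obj X) := by
  have h := l.mul_left X
  rw [IsIso.comp_inv_eq]
  simp [h]

theorem BDLaw.inv_map_mul (X : C) : inv (l.hom.app (F.obj X)) ≫ F.map (F.μ.app X) =
    F.map (l.hom.app X) ≫ F.μ.app (F.obj X) ≫ inv (l.hom.app X) := by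
  have h := l.mul_right X
  rw [IsIso.inv_comp_eq, ← Category.assoc, ← Category.assoc, IsIso.eq_comp_inv]
  simp [h]

theorem BDLaw.inv_naturality {X Y : C} (f : X ⟶ Y) :
    F.map (F.map f) ≫ inv (l.hom.app Y) = inv (l.hom.app X) ≫ F.map (F.map f) := by
  rw [IsIso.eq_inv_comp, ← Category.assoc, IsIso.comp_inv_eq, l.nat]

theorem BDLaw.yang_baxter_inv (X : C) :
    F.map (l.hom.app X) ≫ inv (l.hom.app (F.obj X)) ≫ F.map (inv (l.hom.app X)) =
      inv (l.hom.app (F.obj X)) ≫ F.map (inv (l.hom.app X)) ≫ l.hom.app (F.obj X) := by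
  have h := l.yang_baxter X
  rw [IsIso.eq_inv_comp, Functor.map_inv, ← Category.assoc, ← Category.assoc,
    IsIso.comp_inv_eq, IsIso.comp_inv_eq]
  simp [h]

theorem BDLaw.unit_inv (X : C) :
    F.map (F.η.app X) ≫ inv (l.hom.app X) = F.η.app (F.obj X) := by
  rw [IsIso.comp_inv_eq, l.unit_left]

theorem BDLaw.map_unit_inv (X : C) :
    F.η.app (F.obj X) ≫ inv (l.hom.app X) = F.map (F.η.app X) := by
  rw [IsIso.comp_inv_eq, l.unit_right]

/-- The action of `F^λ` on `R F X`, for `R` right adjoint to `F`. -/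
noncomputable def BDLaw.coinducedOpAction (X : C) :
    F.obj (R.obj (F.obj X)) ⟶ R.obj (F.obj X) :=
  -- Regard `R F X` as functions from `F` to `F X`: `λ⁻¹` moves the acting factor past the argument,
  -- and it then acts on the value by `m · λ`.
  adj.homEquiv (F.obj (R.obj (F.obj X))) (F.obj X)
    ((inv (l.hom.app (R.obj (F.obj X))) : F.obj (F.obj (R.obj (F.obj X))) ⟶ _) ≫
      F.map (adj.counit.app (F.obj X)) ≫ l.opMul X)

theorem BDLaw.map_coinducedOpAction_counit (X : C) :
    F.map (l.coinducedOpAction adj X) ≫ adj.counit.app (F.obj X) =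
      inv (l.hom.app (R.obj (F.obj X))) ≫ F.map (adj.counit.app (F.obj X)) ≫ l.opMul X :=
  map_homEquiv_counit adj _

theorem BDLaw.coinducedOpAction_unit (X : C) :
    F.η.app (R.obj (F.obj X)) ≫ l.coinducedOpAction adj X = 𝟙 _ := by
  apply map_comp_counit_injective adj
  have h1 := F.η.naturality (adj.counit.app (F.obj X))
  have h2 := l.unit_inv (R.obj (F.obj X))
  dsimp at h1 h2 ⊢
  rw [Functor.map_comp, Category.assoc, l.map_coinducedOpAction_counit, reassoc_of% h2,
    ← reassoc_of% h1, l.unit_opMul]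
  simp

/-- The `F F^λ`-module `R F X`, for `R` right adjoint to `F`. -/
noncomputable def BDLaw.coinducedPairAlgebra (X : C) : l.oppositeLaw.compMonad.Algebra :=
  l.pairAlgebra (coinducedAlgebra adj (F.obj X)) (l.coinducedOpAction adj X)
    (l.coinducedOpAction_unit adj X)
    -- Associativity: Yang–Baxter reorders the crossings of the argument with the two acting
    -- factors.
    (by
      apply map_comp_counit_injective adj
      have h1 := l.map_coinducedOpAction_counit adj X
      have h2 := l.map_mul_inv (R.obj (F.obj X))
      have h3 := l.inv_naturality (l.coinducedOpAction adj X)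
      have h4 := congrArg (F.map ·) h1
      have h5 := l.yang_baxter_inv (R.obj (F.obj X))
      have h6 := F.μ.naturality (adj.counit.app (F.obj X))
      have h7 := l.nat (adj.counit.app (F.obj X))
      dsimp [coinducedAlgebra] at *
      simp only [Functor.map_comp, Category.assoc] at *
      rw [h1, reassoc_of% h2, reassoc_of% h3, reassoc_of% h4, reassoc_of% h5, ← reassoc_of% h6,
        l.opMul_assoc, BDLaw.opMul, BDLaw.opMul, Category.assoc, reassoc_of% h7])
    -- Compatibility: `F` acts on arguments and `F^λ` on values, so the actions commute up to `λ`.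
    (by
      apply map_comp_counit_injective adj
      have h0 := map_coinducedAction_counit adj (F.obj X)
      have h1 := l.map_coinducedOpAction_counit adj X
      have h2 := l.inv_map_mul (R.obj (F.obj X))
      have h3 := l.inv_naturality (coinducedAction adj (F.obj X))
      have h4 := congrArg (F.map ·) h0
      have h6 := F.μ.naturality (l.coinducedOpAction adj X)
      change F.map (F.map (coinducedAction adj (F.obj X)) ≫ l.coinducedOpAction adj X) ≫ _ =
        F.map (l.hom.app (R.obj (F.obj X)) ≫ F.map (l.coinducedOpAction adj X) ≫
          coinducedAction adj (F.obj X)) ≫ _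
      dsimp at h0 h1 h2 h3 h4 h6
      simp only [Functor.map_comp, Category.assoc] at h4 ⊢
      rw [h1, reassoc_of% h3, reassoc_of% h4, reassoc_of% h2, h0, reassoc_of% h6, h1])

/-- After transposition, passing the opposite multiplication over a product creates a `λ` that
cancels the `λ⁻¹` in the action. -/
theorem BDLaw.map_coinducedMate_right (X : C) :
    F.map (l.coinducedMate adj X) ≫ l.coinducedOpAction adj X =
      l.opMul (F.obj X) ≫ l.coinducedMate adj X := by
  apply map_comp_counit_injective adj
  have h1 := l.inv_naturality (l.coinducedMate adj X)
  have h2 := congrArg (F.map ·) (l.map_coinducedMate_counit adj X)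
  have h3 := l.mul_right (F.obj X)
  have h4 := l.opMul_assoc X
  dsimp at h1 h2 h3 h4
  simp only [Functor.map_comp] at h2
  rw [Functor.map_comp, Category.assoc, l.map_coinducedOpAction_counit, reassoc_of% h1,
    reassoc_of% h2, h4, Functor.map_comp, Category.assoc, l.map_coinducedMate_counit,
    BDLaw.opMul, Category.assoc, reassoc_of% h3, IsIso.inv_hom_id_assoc]
  simp [BDLaw.opMul, reassoc_of% F.assoc]

/-- `coinducedMate` as a morphism of modules. -/
noncomputable def BDLaw.coinducedMateHom (X : C) :
    l.comparison.obj (F.obj X) ⟶ l.coinducedPairAlgebra adj X :=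
  l.homPairAlgebra (M := coinducedAlgebra adj (F.obj X)) (l.coinducedMate adj X)
    (l.map_coinducedMate_left adj X)
    ((l.map_coinducedMate_right adj X).trans (Category.assoc _ _ _))

/-- A bilinear map into `R F X` is determined by very little: `F`-linearity recovers `θ` from its
value `u` at the unit argument, and `F^λ`-linearity recovers `u` from its restriction along the unit
of `Y`. -/
theorem BDLaw.exists_eq_map_comp_coinducedMate {X Y : C} (θ : F.obj Y ⟶ R.obj (F.obj X))
    (hp : F.map θ ≫ coinducedAction adj (F.obj X) = F.μ.app Y ≫ θ)
    (hq : F.map θ ≫ l.coinducedOpAction adj X = l.opMul Y ≫ θ) :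
    θ = F.map (F.η.app Y ≫ θ ≫ F.η.app (R.obj (F.obj X)) ≫ adj.counit.app (F.obj X)) ≫
      l.coinducedMate adj X := by
  apply map_comp_counit_injective adj
  set u : F.obj Y ⟶ F.obj X := θ ≫ F.η.app (R.obj (F.obj X)) ≫ adj.counit.app (F.obj X) with hu
  have hnat := F.η.naturality θ
  dsimp at hnat
  have h1 : F.map (F.μ.app Y) ≫ F.map θ ≫ adj.counit.app (F.obj X) =
      F.μ.app (F.obj Y) ≫ F.map θ ≫ adj.counit.app (F.obj X) := by
    have h := F.μ.naturality θ
    dsimp at h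
    rw [← Functor.map_comp_assoc, ← hp, Functor.map_comp, Category.assoc,
      map_coinducedAction_counit, reassoc_of% h]
  have h2 : l.opMul Y ≫ u = F.map u ≫ l.opMul X := by
    have h3 := F.η.naturality (F.map θ)
    have h4 := l.map_unit_inv (R.obj (F.obj X))
    have h5 := F.η.naturality (l.coinducedOpAction adj X)
    dsimp at h3 h4 h5
    rw [hu, ← reassoc_of% hq, reassoc_of% h5, l.map_coinducedOpAction_counit, reassoc_of% h4]
    simp only [Functor.map_comp, Category.assoc]
  have h6 : F.map (F.η.app Y ≫ u) ≫ l.opMul X = u := by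
    rw [Functor.map_comp, Category.assoc, ← h2, ← Category.assoc, l.map_unit_opMul]
    exact Category.id_comp u
  have h7 := F.μ.naturality (F.η.app Y ≫ u)
  have h8 := F.η.naturality (F.μ.app Y)
  dsimp at h7 h8
  rw [Functor.map_comp F.toFunctor (F.map _), Category.assoc, l.map_coinducedMate_counit,
    reassoc_of% h7, h6, hu, reassoc_of% hnat, reassoc_of% h8, h1, reassoc_of% F.left_unit]

/-- If `F` is Azumaya and has a right adjoint `R`, then `FFX ⟶ RFX` is invertible. -/
theorem BDLaw.IsAzumaya.isIso_coinducedMate (h : l.IsAzumaya) (X : C) :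
    IsIso (l.coinducedMate adj X) := by
  have : l.comparison.IsEquivalence := h
  let Y := l.comparison.objPreimage (l.coinducedPairAlgebra adj X)
  let e : l.comparison.obj Y ≅ l.coinducedPairAlgebra adj X := l.comparison.objObjPreimageIso _
  let e' : F.obj Y ≅ R.obj (F.obj X) := l.oppositeLaw.compMonad.forget.mapIso e
  -- Essential surjectivity gives `R F X ≅ F Y`, and fullness makes the mate equal to `F s` up to
  -- this isomorphism; it remains to invert `s`.
  obtain ⟨s, hs⟩ := l.comparison.map_surjective (l.coinducedMateHom adj X ≫ e.inv)
  have hs' : F.map s ≫ e'.hom = l.coinducedMate adj X := by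
    rw [← Iso.eq_comp_inv]
    exact congrArg Monad.Algebra.Hom.f hs
  have he : F.map (F.map e'.hom) ≫ F.map (l.coinducedOpAction adj X) ≫
      coinducedAction adj (F.obj X) =
    (F.map (l.hom.app Y) ≫ F.map (F.μ.app Y) ≫ F.μ.app Y) ≫ e'.hom := e.hom.h
  replace he : F.map (F.map e'.hom) ≫ F.map (l.coinducedOpAction adj X) ≫
      (coinducedAlgebra adj (F.obj X)).a = F.map (l.opMul Y) ≫ F.μ.app Y ≫ e'.hom := by
    rw [BDLaw.opMul, Functor.map_comp, Category.assoc]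
    simpa using! he
  -- The isomorphism itself is bilinear, so it factors as `F t` followed by the mate; this `t` is
  -- the inverse of `s`.
  have ht := l.exists_eq_map_comp_coinducedMate adj e'.hom
    (l.map_comp_left_of_linear (l.coinducedOpAction_unit adj X) he)
    (l.map_comp_right_of_linear (M := coinducedAlgebra adj (F.obj X)) he)
  set t : Y ⟶ F.obj X := F.η.app Y ≫ e'.hom ≫ F.η.app (R.obj (F.obj X)) ≫ adj.counit.app (F.obj X)
  have hst : s ≫ t = 𝟙 _ := by
    have h1 := F.η.naturality s
    dsimp at h1
    refine Eq.trans ?_ (l.unit_coinducedMate adj X)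
    rw [← hs', Category.assoc, ← reassoc_of% h1]
  have hts : t ≫ s = 𝟙 Y := by
    -- By faithfulness it suffices that `F t ≫ F s` is the identity, which follows by cancelling
    -- `e'`.
    apply l.comparison.map_injective
    apply Monad.Algebra.Hom.ext
    change F.map (t ≫ s) = F.map (𝟙 Y)
    rw [← cancel_mono e'.hom, Functor.map_comp, Category.assoc, hs', ← ht]
    simp
  have : IsIso s := ⟨t, hst, hts⟩
  rw [← hs']
  infer_instance

end AzumayaMonads

/-! ### From left to right Azumaya, and the remaining equivalences. -/

section

variable {C : Type u} [Category.{v} C] [MonoidalCategory C] [BraidedCategory C] (A : Mon C)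

instance (X : C) : IsIso ((leftBDLaw A).hom.app X) :=
  inferInstanceAs (IsIso ((α_ A.X A.X X).inv ≫ (β_ A.X A.X).hom ▷ X ≫ (α_ A.X A.X X).hom))

/-- With `F = A ⊗ -`, the right adjoint is `D ⊗ -` and its unit is the coevaluation, so the
transpose at the unit object is `chi` up to unitors. -/
theorem coinducedMate_leftBDLaw (D : C) [ExactPairing D A.X] :
    A.X ◁ (ρ_ A.X).inv ≫ (show A.X ⊗ (A.X ⊗ 𝟙_ C) ⟶ D ⊗ (A.X ⊗ 𝟙_ C) from
      (leftBDLaw A).coinducedMate (tensorLeftAdjunction D A.X) (𝟙_ C)) ≫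
        D ◁ (ρ_ A.X).hom = chi A D := by
  change A.X ◁ (ρ_ A.X).inv ≫ (((λ_ (A.X ⊗ A.X ⊗ 𝟙_ C)).inv ≫
    η_ D A.X ▷ (A.X ⊗ A.X ⊗ 𝟙_ C) ≫ (α_ D A.X (A.X ⊗ A.X ⊗ 𝟙_ C)).hom ≫
    D ◁ 𝟙 (A.X ⊗ A.X ⊗ A.X ⊗ 𝟙_ C)) ≫
    D ◁ (((α_ A.X A.X (A.X ⊗ 𝟙_ C)).inv ≫ MonObj.mul ▷ (A.X ⊗ 𝟙_ C)) ≫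
      ((α_ A.X A.X (𝟙_ C)).inv ≫ (β_ A.X A.X).hom ▷ (𝟙_ C) ≫ (α_ A.X A.X (𝟙_ C)).hom) ≫
      (α_ A.X A.X (𝟙_ C)).inv ≫ MonObj.mul ▷ (𝟙_ C))) ≫ D ◁ (ρ_ A.X).hom = _
  rw [chi]
  monoidal

theorem IsLeftAzumaya.isIso_chi (h : IsLeftAzumaya A) (D : C) [ExactPairing D A.X] :
    IsIso (chi A D) := by
  have : IsIso (show A.X ⊗ (A.X ⊗ 𝟙_ C) ⟶ D ⊗ (A.X ⊗ 𝟙_ C) from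
      (leftBDLaw A).coinducedMate (tensorLeftAdjunction D A.X) (𝟙_ C)) :=
    BDLaw.IsAzumaya.isIso_coinducedMate (leftBDLaw A) (tensorLeftAdjunction D A.X) h (𝟙_ C)
  rw [← coinducedMate_leftBDLaw]
  infer_instance

theorem isIso_chi_iff (D : C) [ExactPairing D A.X] : IsIso (chi A D) ↔ IsIso (chi₁ A D) := by
  rw [chi_eq]
  exact ⟨fun _ => IsIso.of_isIso_comp_left (β_ A.X A.X).hom _, fun _ => inferInstance⟩

theorem isRightFaithfullyGalois_iff_chi₁ : IsRightFaithfullyGalois (rightEnvModule A) ↔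
    ∃ (D : C) (_ : ExactPairing D A.X), (tensorLeft A.X).ReflectsIsomorphisms ∧
      IsIso (chi₁ A D) := by
  rw [isRightFaithfullyGalois_iff]
  refine (and_congr_right fun _ => tensorRight_reflectsIsomorphisms_iff A.X).trans ?_
  constructor
  · rintro ⟨⟨D, P, h⟩, hA⟩
    let _ : ExactPairing D A.X := P
    exact ⟨D, P, hA, chi₁_eq A D ▸ h⟩
  · rintro ⟨D, P, hA, h⟩
    exact ⟨⟨D, P, chi₁_eq A D ▸ h⟩, hA⟩

/-- The one passage between the two sides: the monad theorem makes `chi`, hence the right mate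
`chi₁`, invertible for the braided swap of the given dual. -/
theorem IsLeftFaithfullyGalois.isRightFaithfullyGalois [Limits.HasCoequalizers C]
    (h : IsLeftFaithfullyGalois (leftEnvModule A)) :
    IsRightFaithfullyGalois (rightEnvModule A) := by
  rw [isRightFaithfullyGalois_iff_chi₁]
  have hA := (isLeftAzumaya_iff_isLeftFaithfullyGalois A).2 h
  obtain ⟨⟨W, P, -⟩, h'⟩ := h
  let _ : ExactPairing A.X W := P
  let Q : ExactPairing W A.X := BraidedCategory.exactPairing_swap A.X W
  exact ⟨W, Q, h', (isIso_chi_iff A W).1 (hA.isIso_chi A W)⟩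

instance [Limits.HasCoequalizers C] : Limits.HasCoequalizers (MonoidalOpposite C) :=
  Adjunction.hasColimitsOfShape_of_equivalence (MonoidalOpposite.unmopEquiv C).functor

/-- The converse is the same implication applied to `A` in the reversed category. -/
theorem isLeftFaithfullyGalois_iff_isRightFaithfullyGalois [Limits.HasCoequalizers C] :
    IsLeftFaithfullyGalois (leftEnvModule A) ↔ IsRightFaithfullyGalois (rightEnvModule A) :=
  ⟨fun h => h.isRightFaithfullyGalois, fun h => IsLeftFaithfullyGalois.of_mop A
    ((isRightFaithfullyGalois_iff_mop A).1 h).isRightFaithfullyGalois⟩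

theorem isRightAzumaya_iff_isRightFaithfullyGalois [Limits.HasCoequalizers C] :
    IsRightAzumaya A ↔ IsRightFaithfullyGalois (rightEnvModule A) := by
  rw [isRightAzumaya_iff_mop, isRightFaithfullyGalois_iff_mop,
    isLeftAzumaya_iff_isLeftFaithfullyGalois]

theorem comonadic_and_isIso_chi_iff [Limits.HasEqualizers C] :
    (IsFiniteObj A.X ∧ ∃ (D : C) (_ : ExactPairing D A.X),
      Nonempty (ComonadicLeftAdjoint (leftMonad (opAlgebra A)).free) ∧ IsIso (chi A D)) ↔
    IsRightFaithfullyGalois (rightEnvModule A) := by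
  rw [isRightFaithfullyGalois_iff_chi₁]
  constructor
  · rintro ⟨hA, D, P, h1, h2⟩
    exact ⟨D, P, (nonempty_comonadic_free_iff (opAlgebra A) hA).1 h1, (isIso_chi_iff A D).1 h2⟩
  · rintro ⟨D, P, h1, h2⟩
    have hA := isFiniteObj_of_exactPairing A.X D
    exact ⟨hA, D, P, (nonempty_comonadic_free_iff (opAlgebra A) hA).2 h1,
      (isIso_chi_iff A D).2 h2⟩

theorem monadic_and_isIso_chi₁_iff [Limits.HasCoequalizers C] :
    (IsFiniteObj A.X ∧ ∃ (D : C) (_ : ExactPairing D A.X),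
      Nonempty (MonadicRightAdjoint (tensorRight A.X)) ∧ IsIso (chi₁ A D)) ↔
    IsRightFaithfullyGalois (rightEnvModule A) := by
  rw [isRightFaithfullyGalois_iff_chi₁, ← tensorRight_reflectsIsomorphisms_iff]
  constructor
  · rintro ⟨hA, D, P, h1, h2⟩
    exact ⟨D, P, (nonempty_monadic_tensorRight_iff A.X hA).1 h1, h2⟩
  · rintro ⟨D, P, h1, h2⟩
    have hA := isFiniteObj_of_exactPairing A.X D
    exact ⟨hA, D, P, (nonempty_monadic_tensorRight_iff A.X hA).2 h1, h2⟩

end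

end AzumayaTheory

theorem mainTheorem3 {C : Type u} [Category.{v} C] [MonoidalCategory C] [BraidedCategory C]
    [Limits.HasEqualizers C] [Limits.HasCoequalizers C] (A : Mon C) :
    List.TFAE [
      IsLeftAzumaya A,
      IsLeftFaithfullyGalois (leftEnvModule A),
      IsFiniteObj A.X ∧ ∃ (D : C) (_ : ExactPairing D A.X),
        Nonempty (ComonadicLeftAdjoint (leftMonad (opAlgebra A)).free) ∧ IsIso (chi A D),
      IsFiniteObj A.X ∧ ∃ (D : C) (_ : ExactPairing D A.X),
        Nonempty (MonadicRightAdjoint (tensorRight A.X)) ∧ IsIso (chi₁ A D),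
      IsRightFaithfullyGalois (rightEnvModule A),
      IsRightAzumaya A] := by
  tfae_have 1 ↔ 2 := isLeftAzumaya_iff_isLeftFaithfullyGalois A
  tfae_have 2 ↔ 5 := isLeftFaithfullyGalois_iff_isRightFaithfullyGalois A
  tfae_have 3 ↔ 5 := comonadic_and_isIso_chi_iff A
  tfae_have 4 ↔ 5 := monadic_and_isIso_chi₁_iff A
  tfae_have 6 ↔ 5 := isRightAzumaya_iff_isRightFaithfullyGalois A
  tfae_finish
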